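/- Setting. Let $\mathcal I$ be a finite partially ordered set, let $R=\mathbb C\{e_\alpha\mid\alpha\in\mathcal I\}$ be the ring spanned by nonzero pairwise orthogonal idempotents with sum $1$, let $M$ be a finitely generated $R$-bimodule (with $\mathbb C$ acting centrally), let $W\subset M\otimes_R M$ be a sub-bimodule, and let $A=T_R(M)/\langle W\rangle$ be the associated quadratic algebra, graded by $\mathbb N$. For $\alpha\in\mathcal I$ put $\varepsilon_\alpha=\sum_{\gamma\not\le\alpha}e_\gamma$, $P_\alpha=e_\alpha A$, $V_\alpha=e_\alpha A/e_\alpha A\varepsilon_\alpha A$ (the right standard module) and $L_\alpha=A/(A_+\oplus\mathbb C\{e_\beta\mid\beta\ne\alpha\})$. The algebra $A$ is quasi-hereditary if for every $\alpha$ the kernel of $V_\alpha\to L_\alpha$ has a finite filtration with each subquotient isomorphic to some $L_\beta$ with $\beta<\alpha$, and the kernel of $P_\alpha\to V_\alpha$ has a finite filtration with each subquotient isomorphic to some $V_\gamma$ with $\gamma>\alpha$. It is standard Koszul if it is finite-dimensional, quasi-hereditary, and every right standard module and every left standard module has a linear projective resolution, i.e. a graded projective resolution whose $i$-th term is generated in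 degree $i$. Assume that $A$ is standard Koszul and that $A\cong A^{op}$ as $R$-algebras. Let $U$ be a finite-dimensional complex vector space, let $S=\operatorname{Sym}U$ with $U$ in degree $2$, and let $K$ be the fraction field of $S$. Let $\tilde A$ be a flat graded deformation of $A$ over $U^*$: an $\mathbb N$-graded $R$-algebra, flat over $S$, with graded homomorphisms of $\mathbb{C}$-algebras $S\xrightarrow{\,j\,}\tilde A\xrightarrow{\,\pi\,}A$ such that $j$ has central image, $\pi$ is compatible with the maps from $R$, and $\pi$ induces an isomorphism $\tilde A/\langle j(U)\rangle\cong A$ of graded algebras. Put $\tilde V_\alpha=e_\alpha\tilde A/e_\alpha\tilde A\varepsilon_\alpha\tilde A$ (a right $\tilde A$-module), and write $N^\infty=N\otimes_SK$ for an $S$-module $N$. A *deformed standard filtration* of $\tilde A$ is a finite filtration of the regular right $\tilde A$-module by submodules such that each subquotient is isomorphic to a finite direct sum of modules $\tilde V_\alpha$ and no $\tilde V_\alpha$ appears in two consecutive subquotients. It induces a filtration of the right $\tilde A^\infty$-module $\tilde A^\infty$. Theorem. There are unique $S$-algebra homomorphisms $h_\alpha\colon Z(\tilde A)\to S$ $(\alpha\in\mathcal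 I)$ such that $v\cdot\zeta=h_\alpha(\zeta)v$ for all $v\in\tilde V_\alpha$ and $\zeta\in Z(\tilde A)$; deformed standard filtrations of $\tilde A$ exist; and for each deformed standard filtration of $\tilde A$ the following are equivalent: 1. the induced filtration of $\tilde A^\infty$ splits, as a filtration by right $\tilde A^\infty$-submodules; 2. the action map $\tilde A^\infty\to\bigoplus_{\alpha}\operatorname{End}_K(\tilde V_\alpha^\infty)$, sending an element to right multiplication by it, is an isomorphism (i.e. bijective); 3. the map $\bigoplus_\alpha h_\alpha^\infty\colon Z(\tilde A)^\infty\to\bigoplus_{\alpha}K$ is an isomorphism; 4. the maps $h_\alpha$, $\alpha\in\mathcal I$, are pairwise distinct. -/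

import Mathlib

open MulOpposite TensorProduct

universe u

noncomputable section

namespace StdKoszul

/-! ### Right modules over a graded algebra

Right `A`-modules are modules over `Aᵐᵒᵖ`; in particular right ideals of `A` are terms of
`Submodule Aᵐᵒᵖ A`.  Left modules over `A` are right modules over `Aᵐᵒᵖ`. -/

section Modules

variable {A : Type u} [Ring A] [Algebra ℂ A]

/-- `𝒩` makes `N` a graded right module over `A` (graded by `𝒜`).  The pieces are only asked to be
additive subgroups: stability under `𝒜 0`, hence under `ℂ`, is the case `j = 0`. -/
def IsGradedRightModule (𝒜 : ℕ → Submodule ℂ A) {N : Type u} [AddCommGroup N] [Module Aᵐᵒᵖ N]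
    (𝒩 : ℕ → AddSubgroup N) : Prop :=
  DirectSum.IsInternal 𝒩 ∧
    ∀ i j : ℕ, ∀ x ∈ 𝒩 i, ∀ a ∈ 𝒜 j, op a • x ∈ 𝒩 (i + j)

/-- The graded right module `(N, 𝒩)` has a linear projective resolution
`⋯ → P 1 → P 0 → N → 0`: an exact complex of graded right modules and degree preserving maps,
with `P i` projective and generated in degree `i`. -/
def HasLinearProjectiveResolution (𝒜 : ℕ → Submodule ℂ A) {N : Type u} [AddCommGroup N]
    [Module Aᵐᵒᵖ N] (𝒩 : ℕ → AddSubgroup N) : Prop :=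
  ∃ (P : ℕ → Type u) (_ : ∀ i, AddCommGroup (P i)) (_ : ∀ i, Module Aᵐᵒᵖ (P i))
    (𝒢 : ∀ i, ℕ → AddSubgroup (P i))
    (d : ∀ i, P (i + 1) →ₗ[Aᵐᵒᵖ] P i) (ε : P 0 →ₗ[Aᵐᵒᵖ] N),
    (∀ i, IsGradedRightModule 𝒜 (𝒢 i)) ∧
    (∀ i, Module.Projective Aᵐᵒᵖ (P i)) ∧
    (∀ i, Submodule.span Aᵐᵒᵖ (𝒢 i i : Set (P i)) = ⊤) ∧
    (∀ i n, ∀ x ∈ 𝒢 (i + 1) n, d i x ∈ 𝒢 i n) ∧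
    (∀ n, ∀ x ∈ 𝒢 0 n, ε x ∈ 𝒩 n) ∧
    (∀ i, Function.Exact (d (i + 1)) (d i)) ∧
    Function.Exact (d 0) ε ∧
    Function.Surjective ε

end Modules

/-- The `B`-module `N` has a finite filtration each of whose subquotients is isomorphic to `X j` for
some `j` satisfying `p`. -/
def HasFiltrationBy (B : Type*) [Ring B] (N : Type*) [AddCommGroup N] [Module B N]
    {J : Type*} (X : J → Type*) [∀ j, AddCommGroup (X j)] [∀ j, Module B (X j)]
    (p : J → Prop) : Prop :=
  ∃ (m : ℕ) (F : ℕ → Submodule B N), Monotone F ∧ F 0 = ⊥ ∧ F m = ⊤ ∧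
    ∀ k < m, ∃ j, p j ∧
      Nonempty ((F (k + 1) ⧸ (F k).submoduleOf (F (k + 1))) ≃ₗ[B] X j)

/-! ### Simple, projective and standard right modules -/

section Standard

variable {I : Type*} [Fintype I] [PartialOrder I] {A : Type u} [Ring A]

open Classical in
/-- The idempotent `ε_α = ∑_{γ ≰ α} e_γ`. -/
def eps (e : I → A) (α : I) : A := ∑ γ, if γ ≤ α then 0 else e γ

/-- The projective right module `P_α = e_α A`. -/
def proj (e : I → A) (α : I) : Submodule Aᵐᵒᵖ A := Submodule.span Aᵐᵒᵖ {e α}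

/-- The right module `e_α A ε_α A`, which is the kernel of `P_α → V_α`. -/
def kerProjToStd (e : I → A) (α : I) : Submodule Aᵐᵒᵖ A :=
  Submodule.span Aᵐᵒᵖ {x | ∃ a : A, x = e α * a * eps e α}

/-- The right standard module `V_α = e_α A / e_α A ε_α A`. -/
abbrev Std (e : I → A) (α : I) : Type u :=
  proj e α ⧸ (kerProjToStd e α).submoduleOf (proj e α)

variable [Algebra ℂ A]

/-- The grading of `V_α` induced by the grading `𝒜` of `A`. -/
def stdGrading (𝒜 : ℕ → Submodule ℂ A) (e : I → A) (α : I) (n : ℕ) : AddSubgroup (Std e α) :=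
  (((𝒜 n).toAddSubgroup.comap (proj e α).subtype.toAddMonoidHom)).map
    ((kerProjToStd e α).submoduleOf (proj e α)).mkQ.toAddMonoidHom

/-- The right ideal `A_+ ⊕ ℂ{e_β : β ≠ α}`. -/
def simpleIdeal (𝒜 : ℕ → Submodule ℂ A) (e : I → A) (α : I) : Submodule Aᵐᵒᵖ A :=
  Submodule.span Aᵐᵒᵖ ({x | ∃ n, 0 < n ∧ x ∈ 𝒜 n} ∪ {x | ∃ β, β ≠ α ∧ x = e β})

/-- The simple right module `L_α = A / (A_+ ⊕ ℂ{e_β : β ≠ α})`. -/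
abbrev Simple (𝒜 : ℕ → Submodule ℂ A) (e : I → A) (α : I) : Type u := A ⧸ simpleIdeal 𝒜 e α

/-- The kernel of the natural surjection `V_α → L_α`, `[x] ↦ [x]`. -/
def kerStdToSimple (𝒜 : ℕ → Submodule ℂ A) (e : I → A) (α : I) : Submodule Aᵐᵒᵖ (Std e α) :=
  ((simpleIdeal 𝒜 e α).submoduleOf (proj e α)).map
    ((kerProjToStd e α).submoduleOf (proj e α)).mkQ

/-- Quasi-heredity: `ker (V_α → L_α)` is filtered by modules `L_β` with `β < α`, and
`ker (P_α → V_α)` is filtered by modules `V_γ` with `α < γ`. -/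
def IsQuasiHereditary (𝒜 : ℕ → Submodule ℂ A) (e : I → A) : Prop :=
  ∀ α : I,
    HasFiltrationBy Aᵐᵒᵖ (kerStdToSimple 𝒜 e α) (fun β => Simple 𝒜 e β) (fun β => β < α) ∧
    HasFiltrationBy Aᵐᵒᵖ (kerProjToStd e α) (fun γ => Std e γ) (fun γ => α < γ)

/-- The grading of the opposite algebra. -/
def opGrading (𝒜 : ℕ → Submodule ℂ A) (n : ℕ) : Submodule ℂ Aᵐᵒᵖ :=
  (𝒜 n).map (opLinearEquiv ℂ : A ≃ₗ[ℂ] Aᵐᵒᵖ).toLinearMap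

/-- `A` is standard Koszul: finite-dimensional, quasi-hereditary, and all right standard modules
and all left standard modules (that is, the right standard modules of the opposite algebra) have
linear projective resolutions. -/
structure IsStandardKoszul (𝒜 : ℕ → Submodule ℂ A) (e : I → A) : Prop where
  finite : Module.Finite ℂ A
  quasiHereditary : IsQuasiHereditary 𝒜 e
  right_linear : ∀ α : I, HasLinearProjectiveResolution 𝒜 (stdGrading 𝒜 e α)
  left_linear : ∀ α : I, HasLinearProjectiveResolution (opGrading 𝒜)
    (stdGrading (opGrading 𝒜) (fun β => op (e β)) α)

end Standard

/-! ### Quadratic algebras -/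

section Quadratic

variable {I : Type*} [Fintype I] {A : Type u} [Ring A] [Algebra ℂ A]

/-- The canonical map from the free `ℂ`-algebra on the vector space `A_0 ⊕ A_1` to `A`. -/
def tensorToAlg (𝒜 : ℕ → Submodule ℂ A) :
    TensorAlgebra ℂ ↥(𝒜 0 ⊔ 𝒜 1) →ₐ[ℂ] A :=
  TensorAlgebra.lift ℂ (𝒜 0 ⊔ 𝒜 1).subtype

/-- The relations that present the tensor algebra `T_R(M)` of the `R`-bimodule `M`, where `R = A_0`
and `M = A_1`, as a quotient of the free `ℂ`-algebra on `R ⊕ M`: the unit of `R` is the unit, and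
products of an element of `R` with an element of `R` or of `M` are as in `A`. -/
def bimoduleRelations (𝒜 : ℕ → Submodule ℂ A) : Set (TensorAlgebra ℂ ↥(𝒜 0 ⊔ 𝒜 1)) :=
  {t | ∃ x : ↥(𝒜 0 ⊔ 𝒜 1), (x : A) = 1 ∧ t = TensorAlgebra.ι ℂ x - 1} ∪
  {t | ∃ r x y : ↥(𝒜 0 ⊔ 𝒜 1), (r : A) ∈ 𝒜 0 ∧ (y : A) = r * x ∧
    t = TensorAlgebra.ι ℂ r * TensorAlgebra.ι ℂ x - TensorAlgebra.ι ℂ y} ∪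
  {t | ∃ r x y : ↥(𝒜 0 ⊔ 𝒜 1), (r : A) ∈ 𝒜 0 ∧ (y : A) = x * r ∧
    t = TensorAlgebra.ι ℂ x * TensorAlgebra.ι ℂ r - TensorAlgebra.ι ℂ y}

/-- Quadratic relations: sums of products of two elements of `A_1` that vanish in `A`.  Modulo
`bimoduleRelations` they form the kernel `W` of `A_1 ⊗_R A_1 → A_2`. -/
def quadraticRelations (𝒜 : ℕ → Submodule ℂ A) : Set (TensorAlgebra ℂ ↥(𝒜 0 ⊔ 𝒜 1)) :=
  {t | t ∈ Submodule.span ℂ {s | ∃ x y : ↥(𝒜 0 ⊔ 𝒜 1), (x : A) ∈ 𝒜 1 ∧ (y : A) ∈ 𝒜 1 ∧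
      s = TensorAlgebra.ι ℂ x * TensorAlgebra.ι ℂ y} ∧ tensorToAlg 𝒜 t = 0}

/-- The graded algebra `A` is quadratic, `A = T_R(M) / ⟨W⟩`, over the ring `R` spanned by the
nonzero pairwise orthogonal idempotents `e_α`, with `M` a finitely generated `R`-bimodule and
`W ⊆ M ⊗_R M`: the degree zero part has basis `e`, and `A` is the quotient of `T_R(A_1)`
by relations of degree two. -/
structure IsQuadratic (𝒜 : ℕ → Submodule ℂ A) (e : I → A) : Prop where
  idempotents : CompleteOrthogonalIdempotents e
  linearIndependent : LinearIndependent ℂ e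
  span_eq : Submodule.span ℂ (Set.range e) = 𝒜 0
  finite_one : Module.Finite ℂ (𝒜 1)
  surjective : Function.Surjective (tensorToAlg 𝒜)
  ker_eq : TwoSidedIdeal.ker (tensorToAlg 𝒜) =
    TwoSidedIdeal.span (bimoduleRelations 𝒜 ∪ quadraticRelations 𝒜)

end Quadratic

/-! ### Flat graded deformations -/

section Deformation

variable {I : Type*} [Fintype I]

/-- `At` is a flat graded deformation of `A` over `U^*`.  The map `j : Sym U → At` is the structure
map of the `Sym U`-algebra `At`, so it is central; it is graded when elements of `U` have
degree two.  `et` gives the map `R → At`. -/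
structure IsFlatGradedDeformation {A : Type*} [Ring A] [Algebra ℂ A]
    (𝒜 : ℕ → Submodule ℂ A) (e : I → A)
    (U : Type*) [AddCommGroup U] [Module ℂ U]
    {At : Type*} [Ring At] [Algebra ℂ At] [Algebra (SymmetricAlgebra ℂ U) At]
    (ℬ : ℕ → Submodule ℂ At) (et : I → At) (π : At →ₐ[ℂ] A) : Prop where
  idempotents : CompleteOrthogonalIdempotents et
  et_mem : ∀ α, et α ∈ ℬ 0
  map_et : ∀ α, π (et α) = e α
  j_graded : ∀ u : U, algebraMap (SymmetricAlgebra ℂ U) At (SymmetricAlgebra.ι ℂ U u) ∈ ℬ 2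
  π_graded : ∀ n, ∀ x ∈ ℬ n, π x ∈ 𝒜 n
  π_surjective : Function.Surjective π
  ker_π : RingHom.ker π = Ideal.span (Set.range fun u : U =>
    algebraMap (SymmetricAlgebra ℂ U) At (SymmetricAlgebra.ι ℂ U u))
  flat : Module.Flat (SymmetricAlgebra ℂ U) At

end Deformation

/-! ### Notions for an algebra `At` over a commutative ring `S`, and their base change to `K` -/

section Generic

variable {I : Type*} [Fintype I] [PartialOrder I]
  {S : Type*} [CommRing S] {At : Type*} [Ring At] [Algebra S At]

/-- The homomorphism `h` from the centre of `At` to `S` is the central character by which the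
centre acts on the deformed standard module `Std et α`. -/
def IsCentralCharacter (et : I → At) (α : I) (h : Subalgebra.center S At →ₐ[S] S) : Prop :=
  ∀ (ζ : Subalgebra.center S At) (v : Std et α), op (ζ : At) • v = h ζ • v

/-- `F 0 ≤ ⋯ ≤ F m` is a deformed standard filtration of the regular right module `At`:
each subquotient is isomorphic to a (finite) direct sum of deformed standard modules, and no
deformed standard module appears in two consecutive subquotients. -/
def IsDeformedStandardFiltration (et : I → At) (m : ℕ) (F : ℕ → Submodule Atᵐᵒᵖ At) : Prop :=
  Monotone F ∧ F 0 = ⊥ ∧ F m = ⊤ ∧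
  ∃ mult : ℕ → I → ℕ,
    (∀ k < m, Nonempty ((F (k + 1) ⧸ (F k).submoduleOf (F (k + 1)))
      ≃ₗ[Atᵐᵒᵖ] (∀ α : I, Fin (mult k α) → Std et α))) ∧
    ∀ k, k + 1 < m → ∀ α, mult k α = 0 ∨ mult (k + 1) α = 0

variable (K : Type*) [Field K] [Algebra S K]

/-- The right ideal of `K ⊗ At` induced by a right ideal of `At`. -/
def extendRightIdeal (F : Submodule Atᵐᵒᵖ At) : Submodule (K ⊗[S] At)ᵐᵒᵖ (K ⊗[S] At) :=
  Submodule.span _ ((fun a : At => (1 : K) ⊗ₜ[S] a) '' (F : Set At))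

/-- The finite filtration `F 0 ≤ ⋯ ≤ F m` of the `B`-module `N` splits: there are submodules
`G 0, …, G (m - 1)`, with internal direct sum, such that `F k = G 0 ⊕ ⋯ ⊕ G (k - 1)`
for all `k`. -/
def FiltrationSplits {B : Type*} [Ring B] {N : Type*} [AddCommGroup N] [Module B N]
    (m : ℕ) (F : ℕ → Submodule B N) : Prop :=
  ∃ G : Fin m → Submodule B N, iSupIndep G ∧
    ∀ k ≤ m, F k = ⨆ j : Fin m, ⨆ _ : (j : ℕ) < k, G j

/-- The right action of `At` on the deformed standard module, as `S`-linear endomorphisms: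
`a ↦ (v ↦ v a)`. -/
def rightAction (et : I → At) (α : I) : At →ₗ[S] Module.End S (Std et α) :=
  (Algebra.lsmul S S (Std et α) : Atᵐᵒᵖ →ₐ[S] Module.End S (Std et α)).toLinearMap ∘ₗ
    (opLinearEquiv S : At ≃ₗ[S] Atᵐᵒᵖ).toLinearMap

/-- The action map `K ⊗ At → ⨁_α End_K (K ⊗ Std et α)`, `c ⊗ a ↦ (x ⊗ v ↦ c x ⊗ v a)_α`. -/
def actionMap (et : I → At) :
    K ⊗[S] At →ₗ[K] (∀ α : I, Module.End K (K ⊗[S] Std et α)) :=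
  LinearMap.pi fun α => LinearMap.liftBaseChange K
    (LinearMap.baseChangeHom S K (Std et α) (Std et α) ∘ₗ rightAction et α)

/-- The map `K ⊗ Z(At) → ⨁_α K` obtained from the characters `h α`,
`c ⊗ ζ ↦ (c h_α(ζ))_α`. -/
def charMap (h : I → (Subalgebra.center S At →ₐ[S] S)) :
    K ⊗[S] Subalgebra.center S At →ₗ[K] (I → K) :=
  LinearMap.pi fun α => LinearMap.liftBaseChange K
    (Algebra.linearMap S K ∘ₗ (h α).toLinearMap)

end Generic

end StdKoszul

end

/-! Everything rests on a basis of the deformed algebra made of products `x α i * y α j`, where the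
`y α j` give an `S`-basis of the deformed standard module of `α` and the `x α i` play the same role
on the left.

Over `ℂ`, the matrix of the dimensions of `e_α A e_β` is symmetric, by the anti-automorphism, and
equals `M D`, with `M` the multiplicities of standard modules in projectives and `D` the weight
dimensions of standard modules. Both factors are unitriangular, in opposite directions, so `M` is
the transpose of `D` (BGG reciprocity, `eq_of_symmetric_unitriangular`). Hence `dim A = ∑ (dim
V_α)²` (`finrank_eq_sum_sq`). Homogeneous elements of `A e_α` and `e_α A` that span modulo what
factors through larger labels have products spanning `A`, and this count makes the products a basis.

Lifted to the deformation, these elements still span by graded Nakayama (`mul_mul_mem_span`), and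
their products stay independent by flatness (`IsFlatGradedDeformation.linearIndependent`). So the
deformed algebra and its standard modules are free over `S`, of ranks `∑ n_α²` and `n_α`. The basis,
cut by upper sets of labels, gives a standard filtration. Since `e_α` times the algebra times `e_α`
is `S e_α` modulo larger labels, the centre acts on each standard module by scalars, which are the
characters.

By the rank count, condition 2 says that no nonzero element kills all standard modules
(`actionMap_bijective_iff`). A killing element moves each step of a filtration into the previous
one. If the filtration splits, this makes the element zero; in general it makes it nilpotent.
Conversely, condition 2 makes the generic algebra a product of matrix algebras, hence semisimple, so
every filtration splits; its centre is a product of copies of `K`, which gives condition 3, and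
surjectivity in 3 gives 4. Finally, distinct characters yield central elements isolating one label
each, and nilpotence then forces faithfulness (`eq_zero_of_killsStd_of_injective`). -/

noncomputable section

namespace StdKoszul

set_option linter.unusedSectionVars false

/-! ### Weight spaces of idempotents and their additivity along filtrations. -/

section Weight

variable {A : Type*} [Ring A] [Algebra ℂ A]

/-- The vectors of a right module that are fixed by an element of the algebra. -/
def weightSpace (N : Type*) [AddCommGroup N] [Module ℂ N] [Module Aᵐᵒᵖ N] [IsScalarTower ℂ Aᵐᵒᵖ N]
    (a : A) : Submodule ℂ N where
  carrier := {x | op a • x = x}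
  add_mem' {x y} (hx : op a • x = x) (hy : op a • y = y) := by
    change op a • (x + y) = x + y
    rw [smul_add, hx, hy]
  zero_mem' := smul_zero _
  smul_mem' c x (hx : op a • x = x) := by
    change op a • c • x = c • x
    rw [smul_comm, hx]

variable {N : Type*} [AddCommGroup N] [Module ℂ N] [Module Aᵐᵒᵖ N] [IsScalarTower ℂ Aᵐᵒᵖ N]

theorem mem_weightSpace {a : A} {x : N} : x ∈ weightSpace N a ↔ op a • x = x := Iff.rfl

theorem finite_submodule_of_tower [Module.Finite ℂ N] (p : Submodule Aᵐᵒᵖ N) :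
    Module.Finite ℂ p :=
  inferInstanceAs (Module.Finite ℂ (p.restrictScalars ℂ))

theorem finite_quotient_of_tower [Module.Finite ℂ N] (p : Submodule Aᵐᵒᵖ N) :
    Module.Finite ℂ (N ⧸ p) := by
  let g : N →ₗ[ℂ] (N ⧸ p) := p.mkQ.restrictScalars ℂ
  exact Module.Finite.of_surjective g (Submodule.mkQ_surjective p)

theorem finrank_weightSpace_congr {N' : Type*} [AddCommGroup N'] [Module ℂ N'] [Module Aᵐᵒᵖ N']
    [IsScalarTower ℂ Aᵐᵒᵖ N'] (f : N ≃ₗ[Aᵐᵒᵖ] N') (a : A) :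
    Module.finrank ℂ (weightSpace N a) = Module.finrank ℂ (weightSpace N' a) := by
  refine LinearEquiv.finrank_eq (LinearEquiv.ofSubmodules (f.restrictScalars ℂ) _ _ ?_)
  ext y
  simp only [Submodule.mem_map, mem_weightSpace]
  constructor
  · rintro ⟨x, hx, rfl⟩
    change op a • f x = f x
    rw [← map_smul, hx]
  · intro hy
    refine ⟨f.symm y, ?_, f.apply_symm_apply y⟩
    rw [← map_smul, hy]

/-- Acting by an idempotent is an exact functor: a weight vector of the quotient lifts to `op a • x`
for any lift `x`. -/
theorem finrank_weightSpace_eq_add [Module.Finite ℂ N] (p : Submodule Aᵐᵒᵖ N) {a : A}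
    (ha : IsIdempotentElem a) :
    Module.finrank ℂ (weightSpace N a) =
      Module.finrank ℂ (weightSpace p a) + Module.finrank ℂ (weightSpace (N ⧸ p) a) := by
  let g : N →ₗ[ℂ] (N ⧸ p) := p.mkQ.restrictScalars ℂ
  have hg : ∀ x ∈ weightSpace N a, g x ∈ weightSpace (N ⧸ p) a := by
    intro x hx
    change op a • p.mkQ x = p.mkQ x
    rw [← map_smul, mem_weightSpace.1 hx]
  let f : weightSpace N a →ₗ[ℂ] weightSpace (N ⧸ p) a := g.restrict hg
  have hsurj : Function.Surjective f := by
    rintro ⟨y, hy⟩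
    obtain ⟨x, rfl⟩ := p.mkQ_surjective y
    refine ⟨⟨op a • x, ?_⟩, ?_⟩
    · rw [mem_weightSpace, smul_smul, ← op_mul, ha.eq]
    · apply Subtype.ext
      change p.mkQ (op a • x) = p.mkQ x
      rw [map_smul]
      exact hy
  have hker : Module.finrank ℂ (LinearMap.ker f) = Module.finrank ℂ (weightSpace p a) := by
    let j : weightSpace p a →ₗ[ℂ] weightSpace N a :=
      (p.subtype.restrictScalars ℂ).restrict (fun x hx => by
        change op a • (x : N) = x
        conv_rhs => rw [← mem_weightSpace.1 hx]
        rfl)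
    have hj : Function.Injective j := by
      intro x y hxy
      apply Subtype.ext; apply Subtype.ext
      exact congrArg (fun z : weightSpace N a => (z : N)) hxy
    have hr : LinearMap.range j = LinearMap.ker f := by
      ext x
      rw [LinearMap.mem_ker, LinearMap.mem_range]
      constructor
      · rintro ⟨y, rfl⟩
        apply Subtype.ext
        exact (Submodule.Quotient.mk_eq_zero p).2 y.1.2
      · intro hx
        have hx' : p.mkQ (x : N) = 0 := congrArg (fun z : weightSpace (N ⧸ p) a => (z : N ⧸ p)) hx
        have hxp : (x : N) ∈ p := (Submodule.Quotient.mk_eq_zero p).1 hx'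
        exact ⟨⟨⟨x, hxp⟩, Subtype.ext x.2⟩, rfl⟩
    rw [← hr]
    exact LinearMap.finrank_range_of_inj hj
  have := LinearMap.finrank_range_add_finrank_ker f
  rw [LinearMap.range_eq_top.2 hsurj, finrank_top, hker] at this
  omega

/-- The multiplicities do not depend on the idempotent, so one family `c` serves for all weights at
once. This is what makes the dimensions a matrix product. -/
theorem HasFiltrationBy.exists_multiplicity [Module.Finite ℂ N] {J : Type*} [Fintype J]
    {X : J → Type*} [∀ j, AddCommGroup (X j)] [∀ j, Module ℂ (X j)] [∀ j, Module Aᵐᵒᵖ (X j)]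
    [∀ j, IsScalarTower ℂ Aᵐᵒᵖ (X j)] {p : J → Prop} (h : HasFiltrationBy Aᵐᵒᵖ N X p) :
    ∃ c : J → ℕ, (∀ j, c j ≠ 0 → p j) ∧ ∀ a : A, IsIdempotentElem a →
      Module.finrank ℂ (weightSpace N a) = ∑ j, c j * Module.finrank ℂ (weightSpace (X j) a) := by
  classical
  obtain ⟨m, F, hmono, h0, hm, hq⟩ := h
  have key : ∀ k ≤ m, ∃ c : J → ℕ, (∀ j, c j ≠ 0 → p j) ∧ ∀ a : A, IsIdempotentElem a →
      Module.finrank ℂ (weightSpace (F k) a) =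
        ∑ j, c j * Module.finrank ℂ (weightSpace (X j) a) := by
    intro k
    induction k with
    | zero =>
      refine fun _ => ⟨0, by simp, fun a _ => ?_⟩
      have : Subsingleton (F 0) := by rw [h0]; infer_instance
      simp [Module.finrank_zero_of_subsingleton]
    | succ k ih =>
      intro hk
      obtain ⟨c, hc, hca⟩ := ih (by omega)
      obtain ⟨j, hj, ⟨f⟩⟩ := hq k (by omega)
      refine ⟨c + Pi.single j 1, ?_, fun a ha => ?_⟩
      · intro i hi
        by_cases hij : i = j
        · exact hij ▸ hj
        · exact hc i (by simpa [hij] using hi)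
      · have := finite_submodule_of_tower (A := A) (F (k + 1))
        rw [finrank_weightSpace_eq_add ((F k).submoduleOf (F (k + 1))) ha,
          finrank_weightSpace_congr f a,
          finrank_weightSpace_congr (Submodule.submoduleOfEquivOfLe (hmono (Nat.le_succ k))) a,
          hca a ha]
        simp [add_mul, Finset.sum_add_distrib, Pi.single_apply]
  obtain ⟨c, hc, hca⟩ := key m le_rfl
  refine ⟨c, hc, fun a ha => ?_⟩
  rw [← hca a ha, ← finrank_weightSpace_congr Submodule.topEquiv a, hm]

end Weight

/-! ### Vanishing and generation passed from the layers to a filtered module. -/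

section Filtration

variable {A : Type*} [Ring A] {N : Type*} [AddCommGroup N] [Module Aᵐᵒᵖ N]

/-- An idempotent that kills the layers of a filtered module kills the module. -/
theorem HasFiltrationBy.smul_eq_zero {J : Type*}
    {X : J → Type*} [∀ j, AddCommGroup (X j)] [∀ j, Module Aᵐᵒᵖ (X j)]
    {p : J → Prop} (h : HasFiltrationBy Aᵐᵒᵖ N X p) {a : A} (ha : IsIdempotentElem a)
    (hX : ∀ j, p j → ∀ x : X j, op a • x = 0) (x : N) : op a • x = 0 := by
  obtain ⟨m, F, hmono, h0, hm, hq⟩ := h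
  have key : ∀ k ≤ m, ∀ x ∈ F k, op a • x = 0 := by
    intro k
    induction k with
    | zero => intro _ x hx; rw [h0, Submodule.mem_bot] at hx; simp [hx]
    | succ k ih =>
      intro hk x hx
      obtain ⟨j, hj, ⟨f⟩⟩ := hq k (by omega)
      have h1 : op a • (Submodule.Quotient.mk ⟨x, hx⟩ :
          F (k + 1) ⧸ (F k).submoduleOf (F (k + 1))) = 0 := by
        apply f.injective
        rw [map_smul, hX j hj, map_zero]
      rw [← Submodule.Quotient.mk_smul, Submodule.Quotient.mk_eq_zero] at h1
      have h2 := ih (by omega) (op a • x) h1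
      rwa [smul_smul, ← op_mul, ha.eq] at h2
  exact key m le_rfl x (by rw [hm]; trivial)

/-- A module filtered by modules `X j` generated by vectors `x = x a_j`
is generated by vectors of this form. -/
theorem HasFiltrationBy.span_eq_top {J : Type*}
    {X : J → Type*} [∀ j, AddCommGroup (X j)] [∀ j, Module Aᵐᵒᵖ (X j)]
    {p : J → Prop} (h : HasFiltrationBy Aᵐᵒᵖ N X p) (a : J → A)
    (hX : ∀ j, p j → Submodule.span Aᵐᵒᵖ {x : X j | ∃ y, x = op (a j) • y} = ⊤) :
    Submodule.span Aᵐᵒᵖ {x : N | ∃ j, p j ∧ ∃ y, x = op (a j) • y} = ⊤ := by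
  obtain ⟨m, F, hmono, h0, hm, hq⟩ := h
  set T := Submodule.span Aᵐᵒᵖ {x : N | ∃ j, p j ∧ ∃ y, x = op (a j) • y} with hT
  have key : ∀ k ≤ m, F k ≤ T := by
    intro k
    induction k with
    | zero => intro _; rw [h0]; exact bot_le
    | succ k ih =>
      intro hk x hx
      obtain ⟨j, hj, ⟨f⟩⟩ := hq k (by omega)
      let q := ((F k).submoduleOf (F (k + 1))).mkQ
      -- A generator `op (a j) • y` of the layer has the lift `op (a j) • y'`, which is of the same
      -- form and so lies in `T`.
      have h2 : ∀ z : X j, ∃ y : F (k + 1), (y : N) ∈ T ∧ f (q y) = z := by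
        intro z
        have hz : z ∈ Submodule.span Aᵐᵒᵖ {x : X j | ∃ y, x = op (a j) • y} := by
          rw [hX j hj]; trivial
        induction hz using Submodule.span_induction with
        | mem z hz =>
          obtain ⟨y, rfl⟩ := hz
          obtain ⟨y', rfl⟩ := f.surjective y
          obtain ⟨y', rfl⟩ := Submodule.mkQ_surjective _ y'
          exact ⟨op (a j) • y', Submodule.subset_span ⟨j, hj, y', rfl⟩, by simp [q]⟩
        | zero => exact ⟨0, by simp, by simp⟩
        | add u v _ _ hu hv =>
          obtain ⟨y, hy, rfl⟩ := hu
          obtain ⟨y', hy', rfl⟩ := hv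
          exact ⟨y + y', add_mem hy hy', by simp⟩
        | smul b u _ hu =>
          obtain ⟨y, hy, rfl⟩ := hu
          exact ⟨b • y, T.smul_mem b hy, by simp⟩
      obtain ⟨y, hyT, hy⟩ := h2 (f (q ⟨x, hx⟩))
      have h3 : q (⟨x, hx⟩ - y) = 0 := by
        rw [map_sub, f.injective hy, sub_self]
      have h4 : (⟨x, hx⟩ - y) ∈ (F k).submoduleOf (F (k + 1)) :=
        (Submodule.Quotient.mk_eq_zero _).1 h3
      have h5 : x - (y : N) ∈ F k := h4
      simpa using add_mem (ih (by omega) h5) hyT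
  rw [← top_le_iff, ← hm]
  exact key m le_rfl

end Filtration

/-! ### Linear algebra over `ℂ` and unitriangular factorization. -/

section Numerics

variable {V : Type*} [AddCommGroup V] [Module ℂ V] [Module.Finite ℂ V]

theorem finrank_eq_sum_fixed {I : Type*} [Fintype I] (E : I → Module.End ℂ V)
    (hE : CompleteOrthogonalIdempotents E) :
    Module.finrank ℂ V = ∑ i, Module.finrank ℂ (LinearMap.eqLocus (E i) LinearMap.id) := by
  classical
  let f : V →ₗ[ℂ] (∀ i, LinearMap.eqLocus (E i) LinearMap.id) :=
    LinearMap.pi fun i => (E i).codRestrict _ (fun x => by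
      change E i (E i x) = E i x
      rw [← Module.End.mul_apply, (hE.idem i).eq])
  rw [← Module.finrank_pi_fintype]
  refine LinearEquiv.finrank_eq (LinearEquiv.ofBijective f ⟨?_, ?_⟩)
  · rw [← LinearMap.ker_eq_bot, LinearMap.ker_eq_bot']
    intro x hx
    have h1 : ∀ i, E i x = 0 := fun i => congrArg Subtype.val (congrFun hx i)
    have : (∑ i, E i) x = x := by rw [hE.complete]; rfl
    rw [← this, LinearMap.sum_apply]
    exact Finset.sum_eq_zero fun i _ => h1 i
  · intro y
    refine ⟨∑ i, (y i : V), ?_⟩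
    funext i
    apply Subtype.ext
    change E i (∑ j, (y j : V)) = y i
    rw [map_sum, Finset.sum_eq_single i]
    · exact (y i).2
    · intro j _ hji
      have h1 : E j (y j : V) = y j := (y j).2
      rw [← h1, ← Module.End.mul_apply, hE.ortho hji.symm]; rfl
    · simp

/-- Homogeneous (or otherwise special) elements spanning a subspace modulo a smaller one. -/
theorem exists_span_sup_eq {P N : Submodule ℂ V} (H : Set V) (hH : P ≤ Submodule.span ℂ H)
    (hHP : H ⊆ P) (hN : N ≤ P) {n : ℕ}
    (hn : Module.finrank ℂ P = Module.finrank ℂ N + n) :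
    ∃ x : Fin n → V, (∀ i, x i ∈ H) ∧ P ≤ Submodule.span ℂ (Set.range x) ⊔ N := by
  -- A basis of the image of `P` modulo `N` is extracted from the images of the elements of `H`;
  -- lifting it back into `H` gives the family.
  obtain ⟨b, hb, hspan, hli⟩ := exists_linearIndependent ℂ (N.mkQ '' H)
  have hPH : P = Submodule.span ℂ H := le_antisymm hH (Submodule.span_le.2 hHP)
  have hbP : Submodule.span ℂ b = P.map N.mkQ := by
    rw [hspan, Submodule.span_image, ← hPH]
  have hfin : Module.finrank ℂ (P.map N.mkQ) = n := by
    have h1 := LinearMap.finrank_range_add_finrank_ker (N.mkQ.domRestrict P)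
    have h2 : Module.finrank ℂ (LinearMap.ker (N.mkQ.domRestrict P)) = Module.finrank ℂ N := by
      rw [LinearMap.ker_domRestrict, Submodule.ker_mkQ]
      exact LinearEquiv.finrank_eq (Submodule.submoduleOfEquivOfLe hN)
    rw [LinearMap.range_domRestrict] at h1
    omega
  have : Fintype b := (hli.setFinite).fintype
  have hcard : Fintype.card b = n := by
    rw [← hfin, ← hbP, finrank_span_set_eq_card hli, Set.toFinset_card]
  let g : Fin n ≃ b := (Fintype.equivFinOfCardEq hcard).symm
  choose s hsH hs using fun i : Fin n => hb (g i).2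
  refine ⟨s, hsH, fun x hx => ?_⟩
  have h1 : N.mkQ x ∈ Submodule.span ℂ b := by rw [hbP]; exact Submodule.mem_map_of_mem hx
  have h2 : b = N.mkQ '' (Set.range s) := by
    ext z
    constructor
    · intro hz
      exact ⟨s (g.symm ⟨z, hz⟩), ⟨_, rfl⟩, by rw [hs]; simp⟩
    · rintro ⟨_, ⟨i, rfl⟩, rfl⟩
      rw [hs]; exact (g i).2
  rw [h2, Submodule.span_image] at h1
  obtain ⟨y, hy, hyx⟩ := h1
  have h3 : x - y ∈ N := by
    rw [← Submodule.ker_mkQ N, LinearMap.mem_ker, map_sub, hyx, sub_self]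
  rw [← add_sub_cancel y x]
  exact Submodule.add_mem_sup hy h3

/-- Uniqueness of the factorization into unitriangular matrices, for a symmetric matrix. -/
theorem eq_of_symmetric_unitriangular {I : Type*} [Fintype I] [PartialOrder I]
    (M D : I → I → ℕ) (hM1 : ∀ α, M α α = 1) (hD1 : ∀ α, D α α = 1)
    (hM : ∀ α γ, M α γ ≠ 0 → α ≤ γ) (hD : ∀ γ β, D γ β ≠ 0 → β ≤ γ)
    (hsymm : ∀ α β, ∑ γ, M α γ * D γ β = ∑ γ, M β γ * D γ α) (α γ : I) : M α γ = D γ α := by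
  classical
  induction γ using WellFoundedGT.induction generalizing α with
  | ind γ ih =>
  have h := hsymm α γ
  rw [← Finset.add_sum_erase _ _ (Finset.mem_univ γ),
    ← Finset.add_sum_erase _ _ (Finset.mem_univ γ), hD1, hM1, one_mul, mul_one] at h
  -- With the diagonal terms removed, only `δ > γ` contributes, and there the induction hypothesis
  -- turns each `M` into a `D`; cancelling leaves `M α γ = D γ α`.
  have h2 : ∑ δ ∈ Finset.univ.erase γ, M α δ * D δ γ =
      ∑ δ ∈ Finset.univ.erase γ, M γ δ * D δ α := by
    refine Finset.sum_congr rfl fun δ hδ => ?_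
    have hne : δ ≠ γ := (Finset.mem_erase.1 hδ).1
    by_cases hlt : γ < δ
    · rw [ih δ hlt, ih δ hlt, mul_comm]
    · have hle : ¬ γ ≤ δ := fun hle => hlt (lt_of_le_of_ne hle hne.symm)
      rw [not_imp_comm.1 (hD δ γ) hle, not_imp_comm.1 (hM γ δ) hle, mul_zero, zero_mul]
  omega

end Numerics

/-! ### Projectives, standard modules and their generators. -/

section Ideals

variable {I : Type*} [Fintype I] [PartialOrder I] {A : Type u} [Ring A] {e : I → A}

theorem mem_proj_iff (he : CompleteOrthogonalIdempotents e) {α : I} {x : A} :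
    x ∈ proj e α ↔ e α * x = x := by
  rw [proj, Submodule.mem_span_singleton]
  constructor
  · rintro ⟨b, rfl⟩
    rw [← op_unop b, op_smul_eq_mul, ← mul_assoc, (he.idem α).eq]
  · intro h
    exact ⟨op x, by rw [op_smul_eq_mul, h]⟩

theorem mul_eps_of_not_le (he : CompleteOrthogonalIdempotents e) {α δ : I} (h : ¬ δ ≤ α) :
    e δ * eps e α = e δ := by
  classical
  rw [eps, Finset.mul_sum, Finset.sum_eq_single δ]
  · rw [if_neg h, (he.idem δ).eq]
  · intro γ _ hγ
    split_ifs
    · simp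
    · exact he.ortho hγ.symm
  · simp

theorem finite_std [Algebra ℂ A] [Module.Finite ℂ A] (α : I) : Module.Finite ℂ (Std e α) :=
  have := finite_submodule_of_tower (A := A) (proj e α)
  finite_quotient_of_tower (A := A) _

theorem mul_mem_kerProjToStd {α : I} {x : A} (hx : x ∈ kerProjToStd e α) (b : A) :
    x * b ∈ kerProjToStd e α := by
  rw [← op_smul_eq_mul]
  exact Submodule.smul_mem _ _ hx

theorem mul_idem_mul_mem_kerProjToStd (he : CompleteOrthogonalIdempotents e) {α δ : I}
    (h : ¬ δ ≤ α) (b c : A) : e α * b * e δ * c ∈ kerProjToStd e α := by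
  apply mul_mem_kerProjToStd
  refine Submodule.subset_span ⟨b * e δ, ?_⟩
  rw [mul_assoc, mul_assoc, mul_assoc, mul_eps_of_not_le he h]

theorem kerProjToStd_le_proj (he : CompleteOrthogonalIdempotents e) (α : I) :
    kerProjToStd e α ≤ proj e α := by
  rw [kerProjToStd, Submodule.span_le]
  rintro _ ⟨a, rfl⟩
  rw [SetLike.mem_coe, mem_proj_iff he, ← mul_assoc, ← mul_assoc, (he.idem α).eq]

variable (e) in
/-- The generator of the standard module. -/
def Std.gen (α : I) : Std e α :=
  Submodule.Quotient.mk ⟨e α, Submodule.mem_span_singleton_self _⟩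

theorem Std.exists_gen_smul (α : I) (v : Std e α) : ∃ b : A, v = op b • Std.gen e α := by
  obtain ⟨⟨x, hx⟩, rfl⟩ := Submodule.Quotient.mk_surjective _ v
  obtain ⟨b, hb⟩ := Submodule.mem_span_singleton.1 hx
  refine ⟨unop b, ?_⟩
  rw [Std.gen, ← Submodule.Quotient.mk_smul]
  congr 1
  exact Subtype.ext hb.symm

theorem Std.gen_smul_eq_zero_iff {α : I} {b : A} :
    op b • Std.gen e α = 0 ↔ e α * b ∈ kerProjToStd e α := by
  rw [Std.gen, ← Submodule.Quotient.mk_smul, Submodule.Quotient.mk_eq_zero]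
  rfl

theorem Std.gen_smul_self (he : CompleteOrthogonalIdempotents e) (α : I) :
    op (e α) • Std.gen e α = Std.gen e α := by
  rw [Std.gen, ← Submodule.Quotient.mk_smul]
  congr 1
  exact Subtype.ext (he.idem α).eq

theorem Std.smul_eq_zero_of_not_le (he : CompleteOrthogonalIdempotents e) {α β : I}
    (h : ¬ β ≤ α) (v : Std e α) : op (e β) • v = 0 := by
  obtain ⟨b, rfl⟩ := Std.exists_gen_smul α v
  rw [smul_smul, ← op_mul, Std.gen_smul_eq_zero_iff, ← mul_assoc]
  simpa using mul_idem_mul_mem_kerProjToStd he h b 1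

theorem Std.span_weight_eq_top (he : CompleteOrthogonalIdempotents e) (α : I) :
    Submodule.span Aᵐᵒᵖ {x : Std e α | ∃ y, x = op (e α) • y} = ⊤ := by
  rw [← top_le_iff]
  intro v _
  obtain ⟨b, rfl⟩ := Std.exists_gen_smul α v
  exact Submodule.smul_mem _ _ (Submodule.subset_span ⟨_, (Std.gen_smul_self he α).symm⟩)

/-- By definition the kernel passes through idempotents `e_γ` with `γ ≰ α`. Its filtration by
standard modules with `γ > α`, each generated in its own weight, improves this to labels strictly
above `α`, as needed for induction along the order. -/
theorem exists_idem_decomposition_of_mem_kerProjToStd [Algebra ℂ A]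
    (he : CompleteOrthogonalIdempotents e) {α : I}
    (h : HasFiltrationBy Aᵐᵒᵖ (kerProjToStd e α) (fun γ => Std e γ) (fun γ => α < γ)) {x : A}
    (hx : x ∈ kerProjToStd e α) :
    x ∈ Submodule.span ℂ {z | ∃ δ, α < δ ∧ ∃ b c, z = e α * b * e δ * c} := by
  have h1 : (⟨x, hx⟩ : kerProjToStd e α) ∈ Submodule.span Aᵐᵒᵖ
      {x : kerProjToStd e α | ∃ j, α < j ∧ ∃ y, x = op (e j) • y} := by
    rw [h.span_eq_top e fun j _ => Std.span_weight_eq_top he j]; trivial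
  -- The free right factor `d` absorbs the right action, so that a span over the algebra becomes a
  -- span over `ℂ`.
  have key : ∀ z ∈ Submodule.span Aᵐᵒᵖ
      {x : kerProjToStd e α | ∃ j, α < j ∧ ∃ y, x = op (e j) • y}, ∀ d : A,
      (z : A) * d ∈ Submodule.span ℂ {z | ∃ δ, α < δ ∧ ∃ b c, z = e α * b * e δ * c} := by
    intro z hz
    induction hz using Submodule.span_induction with
    | mem z hz =>
      obtain ⟨j, hj, y, rfl⟩ := hz
      intro d
      refine Submodule.subset_span ⟨j, hj, y, d, ?_⟩
      rw [(mem_proj_iff he).1 (kerProjToStd_le_proj he α y.2)]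
      rfl
    | zero => simp
    | add u v _ _ hu hv => intro d; simpa [add_mul] using add_mem (hu d) (hv d)
    | smul b u _ hu =>
      intro d
      have : ((b • u : kerProjToStd e α) : A) * d = (u : A) * (unop b * d) := by
        rw [← mul_assoc]; rfl
      rw [this]
      exact hu _
  simpa using key _ h1 1

end Ideals

/-! ### The degree zero part and the local structure at one idempotent. -/

section GradedIdempotents

variable {I : Type*} [Fintype I] [PartialOrder I] {A : Type u} [Ring A] [Algebra ℂ A]
  (𝒜 : ℕ → Submodule ℂ A) [GradedAlgebra 𝒜] {e : I → A}

theorem mul_idem_eq_smul_of_degree_zero (he : CompleteOrthogonalIdempotents e)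
    (hspan : Submodule.span ℂ (Set.range e) = 𝒜 0) {z : A} (hz : z ∈ 𝒜 0) (α : I) :
    ∃ c : ℂ, z * e α = c • e α := by
  rw [← hspan] at hz
  induction hz using Submodule.span_induction with
  | mem z hz =>
    obtain ⟨β, rfl⟩ := hz
    by_cases h : β = α
    · exact ⟨1, by rw [h, (he.idem α).eq, one_smul]⟩
    · exact ⟨0, by rw [he.ortho h, zero_smul]⟩
  | zero => exact ⟨0, by simp⟩
  | add u v _ _ hu hv =>
    obtain ⟨c, hc⟩ := hu
    obtain ⟨d, hd⟩ := hv
    exact ⟨c + d, by rw [add_mul, hc, hd, add_smul]⟩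
  | smul b u _ hu =>
    obtain ⟨c, hc⟩ := hu
    exact ⟨b * c, by rw [smul_mul_assoc, hc, mul_smul]⟩

theorem sub_projZero_mem_simpleIdeal (α : I) (z : A) :
    z - GradedRing.projZeroRingHom 𝒜 z ∈ simpleIdeal 𝒜 e α := by
  induction z using DirectSum.Decomposition.inductionOn 𝒜 with
  | zero => simp
  | @homogeneous i m =>
    rw [GradedRing.projZeroRingHom_apply]
    by_cases hi : i = 0
    · subst hi
      rw [DirectSum.decompose_of_mem_same 𝒜 m.2, sub_self]
      exact zero_mem _
    · rw [DirectSum.decompose_of_mem_ne 𝒜 m.2 hi, sub_zero]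
      exact Submodule.subset_span (Or.inl ⟨i, Nat.pos_of_ne_zero hi, m.2⟩)
  | add m m' h h' =>
    rw [map_add, add_sub_add_comm]
    exact add_mem h h'

theorem projZero_mem (z : A) : GradedRing.projZeroRingHom 𝒜 z ∈ 𝒜 0 := by
  rw [GradedRing.projZeroRingHom_apply]
  exact SetLike.coe_mem _

theorem projZero_of_mem {z : A} (hz : z ∈ 𝒜 0) : GradedRing.projZeroRingHom 𝒜 z = z := by
  rw [GradedRing.projZeroRingHom_apply, DirectSum.decompose_of_mem_same 𝒜 hz]

theorem Simple.smul_eq_zero (he : CompleteOrthogonalIdempotents e)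
    (hspan : Submodule.span ℂ (Set.range e) = 𝒜 0) {α β : I} (h : α ≠ β) (v : Simple 𝒜 e β) :
    op (e α) • v = 0 := by
  obtain ⟨z, rfl⟩ := Submodule.Quotient.mk_surjective _ v
  rw [← Submodule.Quotient.mk_smul, Submodule.Quotient.mk_eq_zero, op_smul_eq_mul]
  obtain ⟨c, hc⟩ := mul_idem_eq_smul_of_degree_zero 𝒜 he hspan (projZero_mem 𝒜 z) α
  have h1 : op (e α) • (z - GradedRing.projZeroRingHom 𝒜 z) ∈ simpleIdeal 𝒜 e β :=
    Submodule.smul_mem _ _ (sub_projZero_mem_simpleIdeal 𝒜 β z)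
  rw [op_smul_eq_mul, sub_mul, hc] at h1
  have h2 : c • e α ∈ simpleIdeal 𝒜 e β :=
    Submodule.smul_of_tower_mem _ c (Submodule.subset_span (Or.inr ⟨α, h, rfl⟩))
  simpa using add_mem h1 h2

/-- The endomorphisms of the standard module are scalars. -/
theorem exists_smul_sub_mem_kerProjToStd (he : CompleteOrthogonalIdempotents e)
    (hspan : Submodule.span ℂ (Set.range e) = 𝒜 0) {α : I}
    (h : HasFiltrationBy Aᵐᵒᵖ (kerStdToSimple 𝒜 e α) (fun β => Simple 𝒜 e β) (fun β => β < α))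
    (a : A) : ∃ c : ℂ, e α * a * e α - c • e α ∈ kerProjToStd e α := by
  have hmem : ∀ α, e α ∈ 𝒜 0 := fun α => by
    rw [← hspan]; exact Submodule.subset_span ⟨α, rfl⟩
  -- The scalar is the coefficient of `e α` in the degree zero part of `e α * a * e α`; subtracting
  -- it leaves an element of the kernel of the map to the simple module.
  obtain ⟨c, hc⟩ := mul_idem_eq_smul_of_degree_zero 𝒜 he hspan
    (projZero_mem 𝒜 (e α * a)) α
  refine ⟨c, ?_⟩
  set r := e α * a * e α - c • e α with hr
  have hrs : r ∈ simpleIdeal 𝒜 e α := by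
    have := sub_projZero_mem_simpleIdeal 𝒜 (e := e) α (e α * a * e α)
    rwa [map_mul, projZero_of_mem 𝒜 (hmem α), hc] at this
  have hre : r * e α = r := by
    rw [hr, sub_mul, mul_assoc, (he.idem α).eq, smul_mul_assoc, (he.idem α).eq]
  have hrp : r ∈ proj e α := by
    rw [mem_proj_iff he, hr, mul_sub, ← mul_assoc, ← mul_assoc, (he.idem α).eq, mul_smul_comm,
      (he.idem α).eq]
  have hrk : (Submodule.Quotient.mk ⟨r, hrp⟩ : Std e α) ∈ kerStdToSimple 𝒜 e α :=
    Submodule.mem_map_of_mem (p := (simpleIdeal 𝒜 e α).submoduleOf (proj e α)) hrs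
  -- That kernel has only layers `L_β` with `β < α`, on which `e α` is zero; but `r * e α = r`, so
  -- `r` vanishes in the standard module.
  have h1 := h.smul_eq_zero (he.idem α) (fun j hj => Simple.smul_eq_zero 𝒜 he hspan hj.ne')
    ⟨_, hrk⟩
  have h2 : op (e α) • (Submodule.Quotient.mk ⟨r, hrp⟩ : Std e α) = 0 := congrArg Subtype.val h1
  rw [← Submodule.Quotient.mk_smul, Submodule.Quotient.mk_eq_zero] at h2
  have h3 : r * e α ∈ kerProjToStd e α := h2
  rwa [hre] at h3

/-- The projection to degree zero is a ring homomorphism onto a commutative ring of orthogonal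
idempotents. It kills every `e α * b * e δ * c` with `δ ≠ α` but fixes `e α`. This is why standard
modules are nonzero. -/
theorem idem_notMem_span_above (he : CompleteOrthogonalIdempotents e)
    (hli : LinearIndependent ℂ e)
    (hspan : Submodule.span ℂ (Set.range e) = 𝒜 0) (α : I) :
    e α ∉ Submodule.span ℂ {z | ∃ δ, α < δ ∧ ∃ b c, z = e α * b * e δ * c} := by
  have hmem : ∀ α, e α ∈ 𝒜 0 := fun α => by
    rw [← hspan]; exact Submodule.subset_span ⟨α, rfl⟩
  intro h
  have key : ∀ z ∈ Submodule.span ℂ {z | ∃ δ, α < δ ∧ ∃ b c, z = e α * b * e δ * c},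
      GradedRing.projZeroRingHom 𝒜 z = 0 := by
    intro z hz
    induction hz using Submodule.span_induction with
    | mem z hz =>
      obtain ⟨δ, hδ, b, c, rfl⟩ := hz
      obtain ⟨k, hk⟩ := mul_idem_eq_smul_of_degree_zero 𝒜 he hspan (projZero_mem 𝒜 b) δ
      rw [map_mul, map_mul, map_mul, projZero_of_mem 𝒜 (hmem δ), projZero_of_mem 𝒜 (hmem α),
        mul_assoc (e α), hk, mul_smul_comm, he.ortho hδ.ne, smul_zero, zero_mul]
    | zero => simp
    | add u v _ _ hu hv => rw [map_add, hu, hv, add_zero]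
    | smul c u _ hu =>
      rw [GradedRing.projZeroRingHom_apply] at hu ⊢
      rw [DirectSum.decompose_smul, DirectSum.smul_apply, Submodule.coe_smul, hu, smul_zero]
  have := key _ h
  rw [projZero_of_mem 𝒜 (hmem α)] at this
  exact hli.ne_zero α this

theorem mem_span_homogeneous (f : A →ₗ[ℂ] A →ₗ[ℂ] A) (b c : A) :
    f b c ∈ Submodule.span ℂ
      {z | ∃ b c, SetLike.IsHomogeneousElem 𝒜 b ∧ SetLike.IsHomogeneousElem 𝒜 c ∧ z = f b c} := by
  induction b using DirectSum.Decomposition.inductionOn 𝒜 with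
  | zero => simp
  | add m m' h h' => rw [map_add]; exact add_mem h h'
  | @homogeneous i m =>
    induction c using DirectSum.Decomposition.inductionOn 𝒜 with
    | zero => simp
    | add m m' h h' => rw [map_add]; exact add_mem h h'
    | @homogeneous j m' => exact Submodule.subset_span ⟨m, m', ⟨i, m.2⟩, ⟨j, m'.2⟩, rfl⟩

end GradedIdempotents

/-! ### BGG reciprocity and homogeneous bases of standard modules. -/

section Reciprocity

variable {I : Type*} [Fintype I] [PartialOrder I] {A : Type u} [Ring A] [Algebra ℂ A]
  (𝒜 : ℕ → Submodule ℂ A) [GradedAlgebra 𝒜] {e : I → A}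

theorem finrank_eq_sum_weightSpace (he : CompleteOrthogonalIdempotents e) (N : Type*)
    [AddCommGroup N] [Module ℂ N] [Module Aᵐᵒᵖ N] [IsScalarTower ℂ Aᵐᵒᵖ N] [Module.Finite ℂ N] :
    Module.finrank ℂ N = ∑ β, Module.finrank ℂ (weightSpace N (e β)) := by
  have h : CompleteOrthogonalIdempotents (fun β => op (e β)) :=
    { idem := fun β => by
        change op (e β) * op (e β) = op (e β)
        rw [← op_mul, (he.idem β).eq]
      ortho := fun α β hαβ => by
        change op (e α) * op (e β) = 0
        rw [← op_mul, he.ortho hαβ.symm, op_zero]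
      complete := by rw [← Finset.op_sum, he.complete, op_one] }
  have h2 := finrank_eq_sum_fixed _ (h.map (Module.toModuleEnd ℂ (S := Aᵐᵒᵖ) N))
  rw [h2]
  rfl

theorem finrank_eq_sum_proj (he : CompleteOrthogonalIdempotents e) [Module.Finite ℂ A] :
    Module.finrank ℂ A = ∑ α, Module.finrank ℂ (proj e α) := by
  rw [finrank_eq_sum_fixed _ (he.map (Algebra.lmul ℂ A).toRingHom)]
  refine Finset.sum_congr rfl fun α _ => ?_
  have : LinearMap.eqLocus (((Algebra.lmul ℂ A).toRingHom ∘ e) α) LinearMap.id =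
      (proj e α).restrictScalars ℂ := by
    ext x
    rw [Submodule.restrictScalars_mem, mem_proj_iff he]
    rfl
  rw [this]
  rfl

/-- The anti-automorphism fixes the idempotents, so it embeds `e_α A e_β` into `e_β A e_α`. Used in
both directions, this gives the symmetry of the Cartan matrix. -/
theorem finrank_weightSpace_proj_le (he : CompleteOrthogonalIdempotents e) [Module.Finite ℂ A]
    (σ : A ≃ₐ[ℂ] Aᵐᵒᵖ) (hσ : ∀ α, σ (e α) = op (e α)) (α β : I) :
    Module.finrank ℂ (weightSpace (proj e α) (e β)) ≤
      Module.finrank ℂ (weightSpace (proj e β) (e α)) := by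
  have := fun γ => finite_submodule_of_tower (A := A) (proj e γ)
  let τ : A →ₗ[ℂ] A := (opLinearEquiv ℂ).symm.toLinearMap ∘ₗ σ.toLinearMap
  have hτ : ∀ a b, τ (a * b) = τ b * τ a := fun a b => by
    change unop (σ (a * b)) = unop (σ b) * unop (σ a)
    rw [map_mul, unop_mul]
  have hτe : ∀ α, τ (e α) = e α := fun α => by
    change unop (σ (e α)) = e α
    rw [hσ, unop_op]
  have hτinj : Function.Injective τ := fun a b h => σ.injective (unop_injective h)
  have h1 : ∀ x : proj e α, x ∈ weightSpace (proj e α) (e β) → (x : A) * e β = x :=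
    fun x hx => congrArg Subtype.val hx
  have h2 : ∀ x : weightSpace (proj e α) (e β), τ (x : proj e α) ∈ proj e β := fun x => by
    rw [mem_proj_iff he]
    conv_rhs => rw [← h1 x x.2, hτ, hτe]
  let g : weightSpace (proj e α) (e β) →ₗ[ℂ] weightSpace (proj e β) (e α) :=
    { toFun := fun x => ⟨⟨τ (x : proj e α), h2 x⟩, Subtype.ext (by
        change τ (x : proj e α) * e α = τ (x : proj e α)
        have := (mem_proj_iff he).1 (x : proj e α).2
        conv_rhs => rw [← this, hτ, hτe])⟩
      map_add' := fun x y => Subtype.ext (Subtype.ext (map_add τ _ _))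
      map_smul' := fun c x => Subtype.ext (Subtype.ext (map_smul τ c _)) }
  refine LinearMap.finrank_le_finrank_of_injective (f := g) fun x y hxy => ?_
  apply Subtype.ext; apply Subtype.ext
  exact hτinj (congrArg (fun z : weightSpace (proj e β) (e α) => ((z : proj e β) : A)) hxy)

theorem finrank_weightSpace_proj (he : CompleteOrthogonalIdempotents e) [Module.Finite ℂ A]
    (α : I) {a : A} (ha : IsIdempotentElem a) :
    Module.finrank ℂ (weightSpace (proj e α) a) =
      Module.finrank ℂ (weightSpace (kerProjToStd e α) a) +
        Module.finrank ℂ (weightSpace (Std e α) a) := by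
  have := finite_submodule_of_tower (A := A) (proj e α)
  rw [finrank_weightSpace_eq_add ((kerProjToStd e α).submoduleOf (proj e α)) ha,
    finrank_weightSpace_congr (Submodule.submoduleOfEquivOfLe (kerProjToStd_le_proj he α))]

theorem finrank_weightSpace_std_of_not_le (he : CompleteOrthogonalIdempotents e) {α β : I}
    (h : ¬ β ≤ α) : Module.finrank ℂ (weightSpace (Std e α) (e β)) = 0 := by
  have : weightSpace (Std e α) (e β) = ⊥ := by
    rw [eq_bot_iff]
    intro v hv
    rw [mem_weightSpace, Std.smul_eq_zero_of_not_le he h] at hv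
    exact hv.symm
  rw [this, finrank_bot]

/-- The weight space is the line through the generator: `e_α A e_α` is scalar modulo the kernel, and
the generator is nonzero by `idem_notMem_span_above`. -/
theorem finrank_weightSpace_std_self (he : CompleteOrthogonalIdempotents e)
    (hli : LinearIndependent ℂ e) (hspan : Submodule.span ℂ (Set.range e) = 𝒜 0)
    (hqh : IsQuasiHereditary 𝒜 e) (α : I) :
    Module.finrank ℂ (weightSpace (Std e α) (e α)) = 1 := by
  have : weightSpace (Std e α) (e α) = Submodule.span ℂ {Std.gen e α} := by
    apply le_antisymm
    · intro v hv
      obtain ⟨b, rfl⟩ := Std.exists_gen_smul α v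
      obtain ⟨c, hc⟩ := exists_smul_sub_mem_kerProjToStd 𝒜 he hspan (hqh α).1 b
      rw [Submodule.mem_span_singleton]
      refine ⟨c, ?_⟩
      rw [← mem_weightSpace.1 hv, ← sub_eq_zero, ← neg_eq_zero, neg_sub, smul_smul, ← op_mul]
      have h1 : op (b * e α) • Std.gen e α - c • Std.gen e α =
          op (b * e α - c • e α) • Std.gen e α := by
        rw [op_sub, sub_smul, op_smul, smul_assoc, Std.gen_smul_self he]
      rw [h1, Std.gen_smul_eq_zero_iff, mul_sub, ← mul_assoc, mul_smul_comm, (he.idem α).eq]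
      exact hc
    · rw [Submodule.span_le, Set.singleton_subset_iff]
      exact Std.gen_smul_self he α
  rw [this, finrank_span_singleton]
  intro h
  have h1 : op (1 : A) • Std.gen e α = 0 := by rw [h, smul_zero]
  rw [Std.gen_smul_eq_zero_iff, mul_one] at h1
  exact idem_notMem_span_above 𝒜 he hli hspan α
    (exists_idem_decomposition_of_mem_kerProjToStd he (hqh α).2 h1)

/-- The dimension formula that follows from BGG reciprocity. -/
theorem finrank_eq_sum_sq (he : CompleteOrthogonalIdempotents e)
    (hli : LinearIndependent ℂ e) (hspan : Submodule.span ℂ (Set.range e) = 𝒜 0)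
    [Module.Finite ℂ A] (hqh : IsQuasiHereditary 𝒜 e)
    (σ : A ≃ₐ[ℂ] Aᵐᵒᵖ) (hσ : ∀ α, σ (e α) = op (e α)) :
    Module.finrank ℂ A = ∑ α, Module.finrank ℂ (Std e α) * Module.finrank ℂ (Std e α) := by
  classical
  have hfin := fun γ => finite_submodule_of_tower (A := A) (proj e γ)
  have hfin' := fun γ => finite_submodule_of_tower (A := A) (kerProjToStd e γ)
  have hfin'' := fun γ => finite_std (e := e) γ
  choose c hc hcw using fun α => (hqh α).2.exists_multiplicity
  let D : I → I → ℕ := fun γ β => Module.finrank ℂ (weightSpace (Std e γ) (e β))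
  -- The summand `1` on the diagonal counts `V_α` as the top layer of `P_α`; `c α` only counts the
  -- layers of the kernel.
  let M : I → I → ℕ := fun α γ => c α γ + if α = γ then 1 else 0
  have hMD : ∀ α β, Module.finrank ℂ (weightSpace (proj e α) (e β)) = ∑ γ, M α γ * D γ β := by
    intro α β
    rw [finrank_weightSpace_proj he α (he.idem β), hcw α _ (he.idem β)]
    simp [M, D, add_mul, Finset.sum_add_distrib]
  have hc0 : ∀ α, c α α = 0 := fun α => by
    by_contra h
    exact lt_irrefl _ (hc α α h)
  have hrec : ∀ α γ, M α γ = D γ α := by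
    refine eq_of_symmetric_unitriangular M D (fun α => by simp [M, hc0])
      (finrank_weightSpace_std_self 𝒜 he hli hspan hqh) ?_ ?_ ?_
    · intro α γ h
      by_cases hαγ : α = γ
      · exact hαγ.le
      · exact (hc α γ (by simpa [M, hαγ] using h)).le
    · intro γ β h
      by_contra hle
      exact h (finrank_weightSpace_std_of_not_le he hle)
    · intro α β
      rw [← hMD, ← hMD]
      exact le_antisymm (finrank_weightSpace_proj_le he σ hσ α β)
        (finrank_weightSpace_proj_le he σ hσ β α)
  have hn : ∀ γ, Module.finrank ℂ (Std e γ) = ∑ β, D γ β := fun γ =>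
    finrank_eq_sum_weightSpace he _
  rw [finrank_eq_sum_proj he]
  calc ∑ α, Module.finrank ℂ (proj e α) = ∑ α, ∑ β, ∑ γ, D γ α * D γ β := by
        refine Finset.sum_congr rfl fun α _ => ?_
        rw [finrank_eq_sum_weightSpace he]
        refine Finset.sum_congr rfl fun β _ => ?_
        rw [hMD]
        exact Finset.sum_congr rfl fun γ _ => by rw [hrec]
    _ = ∑ γ, ∑ α, ∑ β, D γ α * D γ β := by
        rw [Finset.sum_congr rfl fun α _ => Finset.sum_comm, Finset.sum_comm]
    _ = _ := by
        refine Finset.sum_congr rfl fun γ _ => ?_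
        rw [hn, Finset.sum_mul_sum]

theorem exists_homogeneous_span {P N : Submodule ℂ A} [Module.Finite ℂ A]
    (f : A →ₗ[ℂ] A) (hf : ∀ n, ∀ x ∈ 𝒜 n, f x ∈ 𝒜 n) (hP : P = LinearMap.range f)
    (hN : N ≤ P) {n : ℕ} (hn : Module.finrank ℂ P = Module.finrank ℂ N + n) :
    ∃ x : Fin n → A, (∀ i, SetLike.IsHomogeneousElem 𝒜 (x i) ∧ x i ∈ P) ∧
      P ≤ Submodule.span ℂ (Set.range x) ⊔ N := by
  refine exists_span_sup_eq {z | SetLike.IsHomogeneousElem 𝒜 z ∧ z ∈ P} ?_ (fun z hz => hz.2) hN hn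
  rw [hP]
  rintro _ ⟨z, rfl⟩
  induction z using DirectSum.Decomposition.inductionOn 𝒜 with
  | zero => simp
  | add m m' h h' => rw [map_add]; exact add_mem h h'
  | @homogeneous i m =>
    exact Submodule.subset_span ⟨⟨i, hf i m m.2⟩, ⟨_, rfl⟩⟩

/-- Homogeneous elements of `A` that give bases of the right and the left standard modules, and
what is needed of them. -/
structure IsCellularFamily (e : I → A) (n : I → ℕ) (x y : ∀ α, Fin (n α) → A) : Prop where
  pos : ∀ α, 0 < n α
  finrank_eq : Module.finrank ℂ A = ∑ α, n α * n α
  left_homogeneous : ∀ α i, SetLike.IsHomogeneousElem 𝒜 (x α i)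
  left_mul : ∀ α i, x α i * e α = x α i
  right_homogeneous : ∀ α i, SetLike.IsHomogeneousElem 𝒜 (y α i)
  right_mul : ∀ α i, e α * y α i = y α i
  left_span : ∀ α a, a * e α ∈ Submodule.span ℂ (Set.range (x α) ∪ {z | ∃ δ, α < δ ∧
    ∃ b c, SetLike.IsHomogeneousElem 𝒜 b ∧ SetLike.IsHomogeneousElem 𝒜 c ∧
      z = b * e δ * c * e α})
  right_span : ∀ α a, e α * a ∈ Submodule.span ℂ (Set.range (y α) ∪ {z | ∃ δ, α < δ ∧
    ∃ b c, SetLike.IsHomogeneousElem 𝒜 b ∧ SetLike.IsHomogeneousElem 𝒜 c ∧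
      z = e α * b * e δ * c})
  diag_span : ∀ α a, e α * a * e α ∈ Submodule.span ℂ ({e α} ∪ {z | ∃ δ, α < δ ∧
    ∃ b c, SetLike.IsHomogeneousElem 𝒜 b ∧ SetLike.IsHomogeneousElem 𝒜 c ∧
      z = e α * b * e δ * c * e α})

theorem exists_isCellularFamily (he : CompleteOrthogonalIdempotents e)
    (hli : LinearIndependent ℂ e) (hspan : Submodule.span ℂ (Set.range e) = 𝒜 0)
    [Module.Finite ℂ A] (hqh : IsQuasiHereditary 𝒜 e)
    (σ : A ≃ₐ[ℂ] Aᵐᵒᵖ) (hσ : ∀ α, σ (e α) = op (e α)) :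
    ∃ (n : I → ℕ) (x y : ∀ α, Fin (n α) → A), IsCellularFamily 𝒜 e n x y := by
  have hmem : ∀ α, e α ∈ 𝒜 0 := fun α => by
    rw [← hspan]; exact Submodule.subset_span ⟨α, rfl⟩
  let τ : A ≃ₗ[ℂ] A := σ.toLinearEquiv.trans (opLinearEquiv ℂ).symm
  have hτ : ∀ a b, τ (a * b) = τ b * τ a := fun a b => by
    change unop (σ (a * b)) = unop (σ b) * unop (σ a)
    rw [map_mul, unop_mul]
  have hτe : ∀ α, τ (e α) = e α := fun α => by
    change unop (σ (e α)) = e α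
    rw [hσ, unop_op]
  let P : I → Submodule ℂ A := fun α => (proj e α).restrictScalars ℂ
  let N : I → Submodule ℂ A := fun α => (kerProjToStd e α).restrictScalars ℂ
  have hNs : ∀ α, N α = Submodule.span ℂ {z | ∃ δ, α < δ ∧ ∃ b c, z = e α * b * e δ * c} := by
    intro α
    apply le_antisymm
    · intro z hz
      exact exists_idem_decomposition_of_mem_kerProjToStd he (hqh α).2 hz
    · rw [Submodule.span_le]
      rintro _ ⟨δ, hδ, b, c, rfl⟩
      exact mul_idem_mul_mem_kerProjToStd he hδ.not_ge b c
  have hPm : ∀ α, P α = LinearMap.range (LinearMap.mulLeft ℂ (e α)) := by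
    intro α
    ext z
    rw [LinearMap.mem_range]
    refine ⟨fun hz => ⟨z, (mem_proj_iff he).1 hz⟩, ?_⟩
    rintro ⟨w, rfl⟩
    apply (mem_proj_iff he).2
    rw [LinearMap.mulLeft_apply, ← mul_assoc, (he.idem α).eq]
  have hPm' : ∀ α, (P α).map τ.toLinearMap = LinearMap.range (LinearMap.mulRight ℂ (e α)) := by
    intro α
    ext z
    rw [LinearMap.mem_range, hPm, Submodule.mem_map]
    constructor
    · rintro ⟨_, ⟨w, rfl⟩, rfl⟩
      exact ⟨τ w, by simp [hτ, hτe]⟩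
    · rintro ⟨w, rfl⟩
      exact ⟨_, ⟨τ.symm w, rfl⟩, by simp [hτ, hτe]⟩
  have hNle : ∀ α, N α ≤ P α := fun α => kerProjToStd_le_proj he α
  have hfin := fun γ => finite_submodule_of_tower (A := A) (proj e γ)
  have hfin' := fun γ => finite_submodule_of_tower (A := A) (kerProjToStd e γ)
  have hrank : ∀ α, Module.finrank ℂ (P α) =
      Module.finrank ℂ (N α) + Module.finrank ℂ (Std e α) := by
    intro α
    have hfin'' := finite_std (e := e) α
    change Module.finrank ℂ (proj e α) = Module.finrank ℂ (kerProjToStd e α) + _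
    rw [finrank_eq_sum_weightSpace he (proj e α), finrank_eq_sum_weightSpace he (kerProjToStd e α),
      finrank_eq_sum_weightSpace he (Std e α), ← Finset.sum_add_distrib]
    exact Finset.sum_congr rfl fun β _ => finrank_weightSpace_proj he α (he.idem β)
  have hmapr : ∀ Q : Submodule ℂ A, Module.finrank ℂ (Q.map τ.toLinearMap) =
      Module.finrank ℂ Q := fun Q => LinearEquiv.finrank_map_eq τ Q
  choose y hy hyP using fun α => exists_homogeneous_span 𝒜 (LinearMap.mulLeft ℂ (e α))
    (fun n x hx => by
      have := SetLike.mul_mem_graded (hmem α) hx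
      rwa [zero_add] at this) (hPm α) (hNle α) (hrank α)
  -- The images of the `y` under `τ` would not do: `τ` need not respect the grading. It is used only
  -- to transport dimensions to `A e_α`, where homogeneous elements are chosen anew.
  choose x hx hxP using fun α => exists_homogeneous_span 𝒜 (LinearMap.mulRight ℂ (e α))
    (fun n x hx => by
      have := SetLike.mul_mem_graded hx (hmem α)
      rwa [add_zero] at this) (hPm' α)
    (Submodule.map_mono (hNle α)) (by rw [hmapr, hmapr, hrank α])
  have hNh : ∀ α, N α ≤ Submodule.span ℂ {z | ∃ δ, α < δ ∧
      ∃ b c, SetLike.IsHomogeneousElem 𝒜 b ∧ SetLike.IsHomogeneousElem 𝒜 c ∧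
        z = e α * b * e δ * c} := by
    intro α
    rw [hNs, Submodule.span_le]
    rintro _ ⟨δ, hδ, b, c, rfl⟩
    refine Submodule.span_mono ?_ (mem_span_homogeneous 𝒜
      ((LinearMap.mul ℂ A).comp (LinearMap.mulRight ℂ (e δ) ∘ₗ LinearMap.mulLeft ℂ (e α))) b c)
    rintro _ ⟨b, c, hb, hc, rfl⟩
    exact ⟨δ, hδ, b, c, hb, hc, rfl⟩
  have hNh' : ∀ α, (N α).map τ.toLinearMap ≤ Submodule.span ℂ {z | ∃ δ, α < δ ∧
      ∃ b c, SetLike.IsHomogeneousElem 𝒜 b ∧ SetLike.IsHomogeneousElem 𝒜 c ∧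
        z = b * e δ * c * e α} := by
    intro α
    rw [hNs, Submodule.map_span, Submodule.span_le]
    rintro _ ⟨_, ⟨δ, hδ, b, c, rfl⟩, rfl⟩
    have := mem_span_homogeneous 𝒜
      ((LinearMap.mul ℂ A).compl₂ (LinearMap.mulRight ℂ (e α)) ∘ₗ LinearMap.mulRight ℂ (e δ))
      (τ c) (τ b)
    have h2 : τ (e α * b * e δ * c) = τ c * e δ * (τ b * e α) := by
      simp only [hτ, hτe, mul_assoc]
    rw [SetLike.mem_coe]
    change τ (e α * b * e δ * c) ∈ _
    rw [h2]
    refine Submodule.span_mono ?_ this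
    rintro _ ⟨b, c, hb, hc, rfl⟩
    exact ⟨δ, hδ, b, c, hb, hc, by simp [mul_assoc]⟩
  refine ⟨fun α => Module.finrank ℂ (Std e α), x, y, ?_, ?_, fun α i => (hx α i).1, ?_,
    fun α i => (hy α i).1, ?_, ?_, ?_, ?_⟩
  · intro α
    have hfin'' := finite_std (e := e) α
    have := Submodule.finrank_le (weightSpace (Std e α) (e α))
    rw [finrank_weightSpace_std_self 𝒜 he hli hspan hqh] at this
    exact this
  · exact finrank_eq_sum_sq 𝒜 he hli hspan hqh σ hσ
  · intro α i
    have := (hx α i).2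
    rw [hPm'] at this
    obtain ⟨w, hw⟩ := this
    rw [← hw, LinearMap.mulRight_apply, mul_assoc, (he.idem α).eq]
  · intro α i
    exact (mem_proj_iff he).1 (hy α i).2
  · intro α a
    have : a * e α ∈ (P α).map τ.toLinearMap := by rw [hPm']; exact ⟨a, rfl⟩
    rw [Submodule.span_union]
    exact sup_le_sup_left (hNh' α) _ (hxP α this)
  · intro α a
    have : e α * a ∈ P α := by rw [hPm]; exact ⟨a, rfl⟩
    rw [Submodule.span_union]
    exact sup_le_sup_left (hNh α) _ (hyP α this)
  · intro α a
    obtain ⟨c, hc⟩ := exists_smul_sub_mem_kerProjToStd 𝒜 he hspan (hqh α).1 a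
    have h1 := Submodule.mem_map_of_mem (f := LinearMap.mulRight ℂ (e α)) (hNh α hc)
    rw [Submodule.map_span, LinearMap.mulRight_apply, sub_mul, mul_assoc, smul_mul_assoc,
      (he.idem α).eq] at h1
    rw [Submodule.span_union, ← add_sub_cancel (c • e α) (e α * a * e α)]
    refine Submodule.add_mem_sup (Submodule.smul_mem _ _ (Submodule.subset_span rfl))
      (Submodule.span_mono ?_ h1)
    rintro _ ⟨_, ⟨δ, hδ, b, d, hb, hd, rfl⟩, rfl⟩
    exact ⟨δ, hδ, b, d, hb, hd, rfl⟩

end Reciprocity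

/-! ### Graded Nakayama and flatness: lifting spanning and independence to the deformation. -/

section Lifting

variable {U : Type*} [AddCommGroup U] [Module ℂ U]

variable (U) in
/-- The augmentation of the symmetric algebra. -/
def augmentation : SymmetricAlgebra ℂ U →ₐ[ℂ] ℂ := SymmetricAlgebra.lift (0 : U →ₗ[ℂ] ℂ)

variable {I : Type*} [Fintype I] {A : Type*} [Ring A] [Algebra ℂ A]
  {𝒜 : ℕ → Submodule ℂ A} {e : I → A}
  {B : Type*} [Ring B] [Algebra ℂ B] [Algebra (SymmetricAlgebra ℂ U) B]
  [IsScalarTower ℂ (SymmetricAlgebra ℂ U) B]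
  {ℬ : ℕ → Submodule ℂ B} [GradedAlgebra ℬ] {et : I → B} {π : B →ₐ[ℂ] A}

theorem IsFlatGradedDeformation.apply_smul (h : IsFlatGradedDeformation 𝒜 e U ℬ et π)
    (s : SymmetricAlgebra ℂ U) (b : B) : π (s • b) = augmentation U s • π b := by
  induction s using SymmetricAlgebra.induction generalizing b with
  | algebraMap c => rw [algebraMap_smul, AlgHom.commutes, map_smul]; rfl
  | ι u =>
    have h1 : algebraMap (SymmetricAlgebra ℂ U) B (SymmetricAlgebra.ι ℂ U u) ∈ RingHom.ker π := by
      rw [h.ker_π]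
      exact Ideal.subset_span ⟨u, rfl⟩
    rw [Algebra.smul_def, map_mul, (RingHom.mem_ker).1 h1, zero_mul, augmentation,
      SymmetricAlgebra.lift_ι_apply, LinearMap.zero_apply, zero_smul]
  | mul s t hs ht => rw [mul_smul, hs, ht, map_mul, mul_smul]
  | add s t hs ht => rw [add_smul, map_add, hs, ht, map_add, add_smul]

/-- For use in showing that an `S`-span of homogeneous elements contains the components of its
elements. No grading of `S` is needed: it is enough to test scalars and generators, and the latter
shift degrees by two. -/
theorem decompose_smul_mem (hj : ∀ u : U,
      algebraMap (SymmetricAlgebra ℂ U) B (SymmetricAlgebra.ι ℂ U u) ∈ ℬ 2)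
    {T : Submodule (SymmetricAlgebra ℂ U) B} (s : SymmetricAlgebra ℂ U) {t : B}
    (ht : ∀ n, (DirectSum.decompose ℬ t n : B) ∈ T) (n : ℕ) :
    (DirectSum.decompose ℬ (s • t) n : B) ∈ T := by
  induction s using SymmetricAlgebra.induction generalizing t n with
  | algebraMap c =>
    rw [algebraMap_smul, DirectSum.decompose_smul, DirectSum.smul_apply, Submodule.coe_smul]
    exact Submodule.smul_of_tower_mem T c (ht n)
  | ι u =>
    rw [Algebra.smul_def]
    by_cases hn : 2 ≤ n
    · rw [DirectSum.coe_decompose_mul_of_left_mem_of_le ℬ (hj u) hn, ← Algebra.smul_def]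
      exact T.smul_mem _ (ht _)
    · rw [DirectSum.coe_decompose_mul_of_left_mem_of_not_le ℬ (hj u) hn]
      exact zero_mem _
  | mul s s' hs hs' =>
    rw [mul_smul]
    exact hs (fun n => hs' ht n) n
  | add s s' hs hs' =>
    rw [add_smul, DirectSum.decompose_add, DirectSum.add_apply, Submodule.coe_add]
    exact add_mem (hs ht n) (hs' ht n)

theorem decompose_mem_span (hj : ∀ u : U,
      algebraMap (SymmetricAlgebra ℂ U) B (SymmetricAlgebra.ι ℂ U u) ∈ ℬ 2)
    {G : Set B} (hG : ∀ g ∈ G, SetLike.IsHomogeneousElem ℬ g) {t : B}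
    (ht : t ∈ Submodule.span (SymmetricAlgebra ℂ U) G) (n : ℕ) :
    (DirectSum.decompose ℬ t n : B) ∈ Submodule.span (SymmetricAlgebra ℂ U) G := by
  induction ht using Submodule.span_induction generalizing n with
  | mem x hx =>
    obtain ⟨i, hi⟩ := hG x hx
    by_cases h : i = n
    · subst h
      rw [DirectSum.decompose_of_mem_same ℬ hi]
      exact Submodule.subset_span hx
    · rw [DirectSum.decompose_of_mem_ne ℬ hi h]
      exact zero_mem _
  | zero => simp
  | add x y _ _ hx hy =>
    rw [DirectSum.decompose_add, DirectSum.add_apply, Submodule.coe_add]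
    exact add_mem (hx n) (hy n)
  | smul s x _ hx => exact decompose_smul_mem hj s hx n

/-- Graded Nakayama lemma for the Peirce components of a deformation. -/
theorem IsFlatGradedDeformation.mul_mul_mem_span (h : IsFlatGradedDeformation 𝒜 e U ℬ et π)
    {f f' : B} (hf : f ∈ ℬ 0) (hf' : f' ∈ ℬ 0)
    {G : Set B} (hG : ∀ g ∈ G, SetLike.IsHomogeneousElem ℬ g) (hGf : ∀ g ∈ G, f * g * f' = g)
    (hidem : f * f = f) (hidem' : f' * f' = f')
    (hπ : ∀ a, π f * a * π f' ∈ Submodule.span ℂ (π '' G)) (b : B) :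
    f * b * f' ∈ Submodule.span (SymmetricAlgebra ℂ U) G := by
  set T := Submodule.span (SymmetricAlgebra ℂ U) G with hT
  have hlift : ∀ a ∈ Submodule.span ℂ (π '' G), ∃ t ∈ T, f * t * f' = t ∧ π t = a := by
    intro a ha
    induction ha using Submodule.span_induction with
    | mem x hx =>
      obtain ⟨g, hg, rfl⟩ := hx
      exact ⟨g, Submodule.subset_span hg, hGf g hg, rfl⟩
    | zero => exact ⟨0, by simp, by simp, by simp⟩
    | add x y _ _ hx hy =>
      obtain ⟨t, ht, htf, rfl⟩ := hx
      obtain ⟨t', ht', htf', rfl⟩ := hy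
      exact ⟨t + t', add_mem ht ht', by rw [mul_add, add_mul, htf, htf'], map_add _ _ _⟩
    | smul c x _ hx =>
      obtain ⟨t, ht, htf, rfl⟩ := hx
      exact ⟨c • t, Submodule.smul_of_tower_mem T c ht,
        by rw [mul_smul_comm, smul_mul_assoc, htf], map_smul _ _ _⟩
  have hdeg : ∀ d, ∀ x ∈ ℬ d, f * x * f' ∈ T := by
    intro d
    induction d using Nat.strong_induction_on with
    | _ d ih =>
    intro x hx
    have hxd : f * x * f' ∈ ℬ d := by
      have := SetLike.mul_mem_graded (SetLike.mul_mem_graded hf hx) hf'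
      rwa [zero_add, add_zero] at this
    obtain ⟨t, ht, htf, hπt⟩ := hlift _ (hπ (π x))
    have hker : f * x * f' - t ∈ RingHom.ker π := by
      rw [RingHom.mem_ker, map_sub, hπt, map_mul, map_mul, sub_self]
    rw [h.ker_π] at hker
    -- `Ideal.span` is a left ideal, so the factor `b` is left free to absorb left multiples. A
    -- generator from `U` is central of degree two, which reduces degree `d` to degree `d - 2`,
    -- where the strong induction applies.
    have key : ∀ k ∈ Ideal.span (Set.range fun u : U =>
        algebraMap (SymmetricAlgebra ℂ U) B (SymmetricAlgebra.ι ℂ U u)), ∀ b : B,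
        (DirectSum.decompose ℬ (f * (b * k) * f') d : B) ∈ T := by
      intro k hk
      induction hk using Submodule.span_induction with
      | mem k hk =>
        obtain ⟨u, rfl⟩ := hk
        intro b
        have h1 : f * (b * algebraMap (SymmetricAlgebra ℂ U) B (SymmetricAlgebra.ι ℂ U u)) * f' =
            algebraMap (SymmetricAlgebra ℂ U) B (SymmetricAlgebra.ι ℂ U u) * (f * b * f') := by
          rw [← mul_assoc, ← Algebra.commutes, ← Algebra.smul_def, smul_mul_assoc,
            Algebra.smul_def]
        dsimp only
        rw [h1]
        by_cases hd : 2 ≤ d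
        · rw [DirectSum.coe_decompose_mul_of_left_mem_of_le ℬ (h.j_graded u) hd,
            ← Algebra.smul_def]
          refine T.smul_mem _ ?_
          have h2 : (DirectSum.decompose ℬ (f * b * f') (d - 2) : B) =
              f * (DirectSum.decompose ℬ b (d - 2) : B) * f' := by
            have h3 := DirectSum.coe_decompose_mul_of_right_mem_of_le ℬ (a := f * b) hf'
              (Nat.zero_le (d - 2))
            have h4 := DirectSum.coe_decompose_mul_of_left_mem_of_le ℬ (b := b) hf
              (Nat.zero_le (d - 2))
            rw [Nat.sub_zero] at h3 h4
            rw [h3, h4]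
          rw [h2]
          exact ih (d - 2) (by omega) _ (SetLike.coe_mem _)
        · rw [DirectSum.coe_decompose_mul_of_left_mem_of_not_le ℬ (h.j_graded u) hd]
          exact zero_mem _
      | zero => simp
      | add k k' _ _ hk hk' =>
        intro b
        rw [mul_add, mul_add, add_mul, DirectSum.decompose_add, DirectSum.add_apply,
          Submodule.coe_add]
        exact add_mem (hk b) (hk' b)
      | smul c k _ hk =>
        intro b
        rw [smul_eq_mul, ← mul_assoc b]
        exact hk _
    have h5 := key _ hker 1
    have h6 : f * (1 * (f * x * f' - t)) * f' = f * x * f' - t := by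
      rw [one_mul, mul_sub, sub_mul, htf, ← mul_assoc, ← mul_assoc, hidem, mul_assoc (f * x),
        hidem']
    rw [h6, DirectSum.decompose_sub, DirectSum.sub_apply, AddSubgroupClass.coe_sub,
      DirectSum.decompose_of_mem_same ℬ hxd] at h5
    have h7 := decompose_mem_span h.j_graded hG ht d
    simpa using add_mem h5 h7
  induction b using DirectSum.Decomposition.inductionOn ℬ with
  | zero => simp
  | add m m' hm hm' => rw [mul_add, add_mul]; exact add_mem hm hm'
  | @homogeneous i m => exact hdeg i m m.2

/-- A family in a flat deformation is independent if its reduction is. -/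
theorem IsFlatGradedDeformation.linearIndependent [IsDomain (SymmetricAlgebra ℂ U)]
    (h : IsFlatGradedDeformation 𝒜 e U ℬ et π) {κ : Type*} [Fintype κ] {v : κ → B}
    (hv : LinearIndependent ℂ (π ∘ v)) : LinearIndependent (SymmetricAlgebra ℂ U) v := by
  classical
  have := h.flat
  rw [Fintype.linearIndependent_iff]
  intro s hs
  -- Equational criterion of flatness: `v i = ∑ a i j • y j`, with the coefficients `s` annihilating
  -- the matrix `a` from the left. Independence of the reductions of `v` makes the rows of the
  -- augmented matrix independent.
  obtain ⟨l, a, y, hy, ha⟩ := Module.Flat.isTrivialRelation_of_sum_smul_eq_zero hs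
  have hc : LinearIndependent ℂ (fun i j => augmentation U (a i j)) := by
    refine LinearIndependent.of_comp (Fintype.linearCombination ℂ (fun j => π (y j))) ?_
    convert hv using 1
    funext i
    simp only [Function.comp_apply, Fintype.linearCombination_apply]
    rw [hy i, map_sum]
    exact Finset.sum_congr rfl fun j _ => (h.apply_smul _ _).symm
  obtain ⟨g, hg⟩ := LinearMap.exists_leftInverse_of_injective
    (Fintype.linearCombination ℂ (fun i j => augmentation U (a i j)))
    (LinearMap.ker_eq_bot.2 hc.fintypeLinearCombination_injective)
  -- A right inverse over `ℂ` of the augmented matrix. Then `Q` has augmentation the identity, hence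
  -- nonzero determinant, and over a domain `s Q = 0` forces `s = 0`.
  let R : Matrix (Fin l) κ ℂ := fun j => g fun j' => if j = j' then 1 else 0
  let M : Matrix κ (Fin l) (SymmetricAlgebra ℂ U) := Matrix.of a
  let Q : Matrix κ κ (SymmetricAlgebra ℂ U) := M * R.map (algebraMap ℂ (SymmetricAlgebra ℂ U))
  have hQ : Q.map (augmentation U) = 1 := by
    ext i k
    have h1 : g (fun j => augmentation U (a i j)) k = (1 : Matrix κ κ ℂ) i k := by
      have := LinearMap.congr_fun hg (Pi.single i 1)
      rw [LinearMap.comp_apply, Fintype.linearCombination_apply_single, one_smul] at this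
      rw [this, Matrix.one_apply, LinearMap.id_apply, Pi.single_apply]
      simp only [eq_comm]
    have h2 : Q i k = ∑ j, a i j * algebraMap ℂ (SymmetricAlgebra ℂ U) (R j k) := rfl
    rw [← h1, LinearMap.pi_apply_eq_sum_univ g, Matrix.map_apply, h2, map_sum,
      Finset.sum_apply]
    refine Finset.sum_congr rfl fun j _ => ?_
    rw [map_mul, AlgHom.commutes]
    rfl
  have hdet : Q.det ≠ 0 := by
    intro h0
    have h1 : augmentation U Q.det = (Q.map (augmentation U)).det :=
      RingHom.map_det (augmentation U).toRingHom Q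
    rw [h0, hQ, Matrix.det_one, map_zero] at h1
    exact zero_ne_one h1
  have hs0 : Matrix.vecMul s M = 0 := funext fun j => ha j
  have hsQ : Matrix.vecMul s Q = 0 := by
    rw [← Matrix.vecMul_vecMul, hs0, Matrix.zero_vecMul]
  exact fun i => congrFun (Matrix.eq_zero_of_vecMul_eq_zero hdet hsQ) i

end Lifting

/-! ### Cellular bases and spans of cells. -/

section Cellular

variable {I : Type*} [Fintype I] [PartialOrder I] (S : Type*) [CommRing S]
  {B : Type*} [Ring B] [Algebra S B]

/-- Families of elements that give bases of the right and the left standard modules of an algebra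
over `S`, such that their products are linearly independent. -/
structure IsCellularBasis (e : I → B) (n : I → ℕ) (x y : ∀ α, Fin (n α) → B) : Prop where
  idempotents : CompleteOrthogonalIdempotents e
  pos : ∀ α, 0 < n α
  left_mul : ∀ α i, x α i * e α = x α i
  right_mul : ∀ α i, e α * y α i = y α i
  left_span : ∀ α a, a * e α ∈ Submodule.span S (Set.range (x α) ∪
    {z | ∃ δ, α < δ ∧ ∃ b c, z = b * e δ * c * e α})
  right_span : ∀ α a, e α * a ∈ Submodule.span S (Set.range (y α) ∪
    {z | ∃ δ, α < δ ∧ ∃ b c, z = e α * b * e δ * c})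
  diag_span : ∀ α a, e α * a * e α ∈ Submodule.span S ({e α} ∪
    {z | ∃ δ, α < δ ∧ ∃ b c, z = e α * b * e δ * c * e α})
  linearIndependent : LinearIndependent S
    (fun t : Σ α, Fin (n α) × Fin (n α) => x t.1 t.2.1 * y t.1 t.2.2)

/-- The span of the products of elements of a cellular basis with labels in a given set. -/
def cellSpan {n : I → ℕ} (x y : ∀ α, Fin (n α) → B) (Γ : Set I) : Submodule S B :=
  Submodule.span S ((fun t : Σ α, Fin (n α) × Fin (n α) => x t.1 t.2.1 * y t.1 t.2.2) ''
    {t | t.1 ∈ Γ})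

variable {S}

theorem mul_mem_cellSpan {n : I → ℕ} (x y : ∀ α, Fin (n α) → B) {Γ : Set I} {α : I} (hα : α ∈ Γ)
    (i j : Fin (n α)) : x α i * y α j ∈ cellSpan S x y Γ :=
  Submodule.subset_span ⟨⟨α, i, j⟩, hα, rfl⟩

theorem cellSpan_mono {n : I → ℕ} (x y : ∀ α, Fin (n α) → B) {Γ Γ' : Set I} (h : Γ ⊆ Γ') :
    cellSpan S x y Γ ≤ cellSpan S x y Γ' :=
  Submodule.span_mono (Set.image_mono fun _ ht => h ht)

/-- Descending induction on `α`: split the product as `(b * e α) * (e α * c)` and expand both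
factors. Each term is a basis product for `α` or passes through a larger idempotent. -/
theorem mul_idem_mul_mem_cellSpan {e : I → B} {n : I → ℕ} {x y : ∀ α, Fin (n α) → B}
    (he : CompleteOrthogonalIdempotents e)
    (left_span : ∀ α a, a * e α ∈ Submodule.span S (Set.range (x α) ∪
      {z | ∃ δ, α < δ ∧ ∃ b c, z = b * e δ * c * e α}))
    (right_span : ∀ α a, e α * a ∈ Submodule.span S (Set.range (y α) ∪
      {z | ∃ δ, α < δ ∧ ∃ b c, z = e α * b * e δ * c})) (α : I) (b c : B) :
    b * e α * c ∈ cellSpan S x y (Set.Ici α) := by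
  induction α using WellFoundedGT.induction generalizing b c with
  | ind α ih =>
  have hup : ∀ δ, α < δ → ∀ b c, b * e δ * c ∈ cellSpan S x y (Set.Ici α) := fun δ hδ b c =>
    cellSpan_mono x y (Set.Ici_subset_Ici.2 hδ.le) (ih δ hδ b c)
  have h1 : b * e α * c = (b * e α) * (e α * c) := by
    rw [mul_assoc (b : B) (e α) (e α * c), ← mul_assoc (e α) (e α) c, (he.idem α).eq, mul_assoc]
  rw [h1]
  have key : ∀ z ∈ Submodule.span S (Set.range (x α) ∪
      {z | ∃ δ, α < δ ∧ ∃ b c, z = b * e δ * c * e α}),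
      ∀ w ∈ Submodule.span S (Set.range (y α) ∪
      {z | ∃ δ, α < δ ∧ ∃ b c, z = e α * b * e δ * c}), z * w ∈ cellSpan S x y (Set.Ici α) := by
    intro z hz w hw
    induction hz using Submodule.span_induction with
    | zero => simp
    | add u v _ _ hu hv => rw [add_mul]; exact add_mem hu hv
    | smul s u _ hu => rw [smul_mul_assoc]; exact Submodule.smul_mem _ _ hu
    | mem z hz =>
      rcases hz with ⟨i, rfl⟩ | ⟨δ, hδ, b, c, rfl⟩
      · induction hw using Submodule.span_induction with
        | zero => simp
        | add u v _ _ hu hv => rw [mul_add]; exact add_mem hu hv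
        | smul s u _ hu => rw [mul_smul_comm]; exact Submodule.smul_mem _ _ hu
        | mem w hw =>
          rcases hw with ⟨j, rfl⟩ | ⟨δ, hδ, b, c, rfl⟩
          · exact mul_mem_cellSpan x y (Set.mem_Ici.2 le_rfl) i j
          · rw [← mul_assoc, ← mul_assoc]
            exact hup δ hδ _ _
      · rw [mul_assoc, mul_assoc]
        exact hup δ hδ _ _
  exact key _ (left_span α b) _ (right_span α c)

theorem cellSpan_univ {e : I → B} {n : I → ℕ} {x y : ∀ α, Fin (n α) → B}
    (he : CompleteOrthogonalIdempotents e)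
    (left_span : ∀ α a, a * e α ∈ Submodule.span S (Set.range (x α) ∪
      {z | ∃ δ, α < δ ∧ ∃ b c, z = b * e δ * c * e α}))
    (right_span : ∀ α a, e α * a ∈ Submodule.span S (Set.range (y α) ∪
      {z | ∃ δ, α < δ ∧ ∃ b c, z = e α * b * e δ * c})) :
    cellSpan S x y Set.univ = ⊤ := by
  rw [← top_le_iff]
  intro b _
  rw [← mul_one b, ← he.complete, Finset.mul_sum]
  refine sum_mem fun α _ => ?_
  rw [← mul_one (b * e α)]
  exact cellSpan_mono x y (Set.subset_univ _)
    (mul_idem_mul_mem_cellSpan he left_span right_span α b 1)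

end Cellular

/-! ### The cellular basis of a flat graded deformation. -/

section Deformation

variable {U : Type*} [AddCommGroup U] [Module ℂ U]
  {I : Type*} [Fintype I] [PartialOrder I] {A : Type u} [Ring A] [Algebra ℂ A]
  {𝒜 : ℕ → Submodule ℂ A} [GradedAlgebra 𝒜] {e : I → A}
  {B : Type*} [Ring B] [Algebra ℂ B] [Algebra (SymmetricAlgebra ℂ U) B]
  [IsScalarTower ℂ (SymmetricAlgebra ℂ U) B]
  {ℬ : ℕ → Submodule ℂ B} [GradedAlgebra ℬ] {et : I → B} {π : B →ₐ[ℂ] A}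

theorem IsFlatGradedDeformation.exists_homogeneous_lift
    (h : IsFlatGradedDeformation 𝒜 e U ℬ et π) {a : A} (ha : SetLike.IsHomogeneousElem 𝒜 a) :
    ∃ b, SetLike.IsHomogeneousElem ℬ b ∧ π b = a := by
  obtain ⟨n, hn⟩ := ha
  obtain ⟨b, rfl⟩ := h.π_surjective a
  refine ⟨DirectSum.decompose ℬ b n, ⟨n, SetLike.coe_mem _⟩, ?_⟩
  have key : ∀ b : B, π (DirectSum.decompose ℬ b n) = (DirectSum.decompose 𝒜 (π b) n : A) := by
    intro b
    induction b using DirectSum.Decomposition.inductionOn ℬ with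
    | zero => simp
    | add m m' hm hm' =>
      rw [DirectSum.decompose_add, DirectSum.add_apply, Submodule.coe_add, map_add, map_add,
        DirectSum.decompose_add, DirectSum.add_apply, Submodule.coe_add, hm, hm']
    | @homogeneous i m =>
      have h1 := h.π_graded i m m.2
      by_cases hi : i = n
      · subst hi
        rw [DirectSum.decompose_of_mem_same ℬ m.2, DirectSum.decompose_of_mem_same 𝒜 h1]
      · rw [DirectSum.decompose_of_mem_ne ℬ m.2 hi, DirectSum.decompose_of_mem_ne 𝒜 h1 hi, map_zero]
  rw [key, DirectSum.decompose_of_mem_same 𝒜 hn]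

theorem isHomogeneousElem_mul {b c : B} (hb : SetLike.IsHomogeneousElem ℬ b)
    (hc : SetLike.IsHomogeneousElem ℬ c) : SetLike.IsHomogeneousElem ℬ (b * c) := by
  obtain ⟨i, hi⟩ := hb
  obtain ⟨j, hj⟩ := hc
  exact ⟨i + j, SetLike.mul_mem_graded hi hj⟩

theorem IsFlatGradedDeformation.exists_isCellularBasis [IsDomain (SymmetricAlgebra ℂ U)]
    (h : IsFlatGradedDeformation 𝒜 e U ℬ et π) [Module.Finite ℂ A] {n : I → ℕ}
    {x y : ∀ α, Fin (n α) → A} (hxy : IsCellularFamily 𝒜 e n x y) :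
    ∃ X Y : ∀ α, Fin (n α) → B, IsCellularBasis (SymmetricAlgebra ℂ U) et n X Y := by
  choose X₀ hX₀ hX₀π using fun α i => h.exists_homogeneous_lift (hxy.left_homogeneous α i)
  choose Y₀ hY₀ hY₀π using fun α i => h.exists_homogeneous_lift (hxy.right_homogeneous α i)
  -- A homogeneous lift need not lie in the right Peirce component; multiplying by `et α` corrects
  -- this and does not change the image under `π`.
  let X : ∀ α, Fin (n α) → B := fun α i => X₀ α i * et α
  let Y : ∀ α, Fin (n α) → B := fun α i => et α * Y₀ α i
  have he := h.idempotents
  have heh : ∀ α, SetLike.IsHomogeneousElem ℬ (et α) := fun α => ⟨0, h.et_mem α⟩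
  have hX : ∀ α i, SetLike.IsHomogeneousElem ℬ (X α i) :=
    fun α i => isHomogeneousElem_mul (hX₀ α i) (heh α)
  have hY : ∀ α i, SetLike.IsHomogeneousElem ℬ (Y α i) :=
    fun α i => isHomogeneousElem_mul (heh α) (hY₀ α i)
  have hXe : ∀ α i, X α i * et α = X α i := fun α i => by
    simp only [X, mul_assoc, (he.idem α).eq]
  have hYe : ∀ α i, et α * Y α i = Y α i := fun α i => by
    simp only [Y, ← mul_assoc, (he.idem α).eq]
  have hXπ : ∀ α i, π (X α i) = x α i := fun α i => by
    rw [map_mul, hX₀π, h.map_et, hxy.left_mul]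
  have hYπ : ∀ α i, π (Y α i) = y α i := fun α i => by
    rw [map_mul, hY₀π, h.map_et, hxy.right_mul]
  have h1 : (1 : B) ∈ ℬ 0 := SetLike.one_mem_graded ℬ
  have left_span : ∀ α a, a * et α ∈ Submodule.span (SymmetricAlgebra ℂ U) (Set.range (X α) ∪
      {z | ∃ δ, α < δ ∧ ∃ b c, z = b * et δ * c * et α}) := by
    intro α a
    have := h.mul_mul_mem_span h1 (h.et_mem α) (G := Set.range (X α) ∪ {z | ∃ δ, α < δ ∧
      ∃ b c, SetLike.IsHomogeneousElem ℬ b ∧ SetLike.IsHomogeneousElem ℬ c ∧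
      z = b * et δ * c * et α}) ?_ ?_ (mul_one _) (he.idem α).eq ?_ a
    · rw [one_mul] at this
      refine Submodule.span_mono (Set.union_subset_union_right _ ?_) this
      rintro z ⟨δ, hδ, b, c, _, _, hz⟩
      exact ⟨δ, hδ, b, c, hz⟩
    · rintro g (⟨i, rfl⟩ | ⟨δ, hδ, b, c, hb, hc, rfl⟩)
      · exact hX α i
      · exact isHomogeneousElem_mul (isHomogeneousElem_mul
          (isHomogeneousElem_mul hb (heh δ)) hc) (heh α)
    · rintro g (⟨i, rfl⟩ | ⟨δ, hδ, b, c, hb, hc, rfl⟩)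
      · rw [one_mul, hXe]
      · rw [one_mul, mul_assoc _ (et α) (et α), (he.idem α).eq]
    · intro a
      rw [map_one, one_mul, h.map_et]
      refine Submodule.span_mono ?_ (hxy.left_span α a)
      rintro z (⟨i, rfl⟩ | ⟨δ, hδ, b, c, hb, hc, rfl⟩)
      · exact ⟨X α i, Or.inl ⟨i, rfl⟩, hXπ α i⟩
      · obtain ⟨b', hb', rfl⟩ := h.exists_homogeneous_lift hb
        obtain ⟨c', hc', rfl⟩ := h.exists_homogeneous_lift hc
        exact ⟨_, Or.inr ⟨δ, hδ, b', c', hb', hc', rfl⟩, by simp only [map_mul, h.map_et]⟩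
  have right_span : ∀ α a, et α * a ∈ Submodule.span (SymmetricAlgebra ℂ U) (Set.range (Y α) ∪
      {z | ∃ δ, α < δ ∧ ∃ b c, z = et α * b * et δ * c}) := by
    intro α a
    have := h.mul_mul_mem_span (h.et_mem α) h1 (G := Set.range (Y α) ∪ {z | ∃ δ, α < δ ∧
      ∃ b c, SetLike.IsHomogeneousElem ℬ b ∧ SetLike.IsHomogeneousElem ℬ c ∧
      z = et α * b * et δ * c}) ?_ ?_ (he.idem α).eq (mul_one _) ?_ a
    · rw [mul_one] at this
      refine Submodule.span_mono (Set.union_subset_union_right _ ?_) this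
      rintro z ⟨δ, hδ, b, c, _, _, hz⟩
      exact ⟨δ, hδ, b, c, hz⟩
    · rintro g (⟨i, rfl⟩ | ⟨δ, hδ, b, c, hb, hc, rfl⟩)
      · exact hY α i
      · exact isHomogeneousElem_mul (isHomogeneousElem_mul
          (isHomogeneousElem_mul (heh α) hb) (heh δ)) hc
    · rintro g (⟨i, rfl⟩ | ⟨δ, hδ, b, c, hb, hc, rfl⟩)
      · rw [mul_one, hYe]
      · simp only [mul_one, ← mul_assoc, (he.idem α).eq]
    · intro a
      rw [map_one, mul_one, h.map_et]
      refine Submodule.span_mono ?_ (hxy.right_span α a)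
      rintro z (⟨i, rfl⟩ | ⟨δ, hδ, b, c, hb, hc, rfl⟩)
      · exact ⟨Y α i, Or.inl ⟨i, rfl⟩, hYπ α i⟩
      · obtain ⟨b', hb', rfl⟩ := h.exists_homogeneous_lift hb
        obtain ⟨c', hc', rfl⟩ := h.exists_homogeneous_lift hc
        exact ⟨_, Or.inr ⟨δ, hδ, b', c', hb', hc', rfl⟩, by simp only [map_mul, h.map_et]⟩
  have diag_span : ∀ α a, et α * a * et α ∈ Submodule.span (SymmetricAlgebra ℂ U) ({et α} ∪
      {z | ∃ δ, α < δ ∧ ∃ b c, z = et α * b * et δ * c * et α}) := by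
    intro α a
    have := h.mul_mul_mem_span (h.et_mem α) (h.et_mem α) (G := {et α} ∪ {z | ∃ δ, α < δ ∧
      ∃ b c, SetLike.IsHomogeneousElem ℬ b ∧ SetLike.IsHomogeneousElem ℬ c ∧
      z = et α * b * et δ * c * et α}) ?_ ?_ (he.idem α).eq (he.idem α).eq ?_ a
    · refine Submodule.span_mono (Set.union_subset_union_right _ ?_) this
      rintro z ⟨δ, hδ, b, c, _, _, hz⟩
      exact ⟨δ, hδ, b, c, hz⟩
    · rintro g (rfl | ⟨δ, hδ, b, c, hb, hc, rfl⟩)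
      · exact heh α
      · exact isHomogeneousElem_mul (isHomogeneousElem_mul (isHomogeneousElem_mul
          (isHomogeneousElem_mul (heh α) hb) (heh δ)) hc) (heh α)
    · rintro g (rfl | ⟨δ, hδ, b, c, hb, hc, rfl⟩)
      · rw [(he.idem α).eq, (he.idem α).eq]
      · simp only [← mul_assoc, (he.idem α).eq]
        rw [mul_assoc _ (et α) (et α), (he.idem α).eq]
    · intro a
      rw [h.map_et]
      refine Submodule.span_mono ?_ (hxy.diag_span α a)
      rintro z (rfl | ⟨δ, hδ, b, c, hb, hc, rfl⟩)
      · exact ⟨et α, Or.inl rfl, h.map_et α⟩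
      · obtain ⟨b', hb', rfl⟩ := h.exists_homogeneous_lift hb
        obtain ⟨c', hc', rfl⟩ := h.exists_homogeneous_lift hc
        exact ⟨_, Or.inr ⟨δ, hδ, b', c', hb', hc', rfl⟩, by simp only [map_mul, h.map_et]⟩
  refine ⟨X, Y, he, hxy.pos, hXe, hYe, left_span, right_span, diag_span, ?_⟩
  -- By flatness it is enough to see independence in `A`. There the products span, as images of a
  -- spanning family, and their number is the dimension.
  apply h.linearIndependent
  apply linearIndependent_of_top_le_span_of_card_eq_finrank
  · intro a _
    obtain ⟨b, rfl⟩ := h.π_surjective a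
    have hb : b ∈ cellSpan (SymmetricAlgebra ℂ U) X Y Set.univ := by
      rw [cellSpan_univ he left_span right_span]; trivial
    induction hb using Submodule.span_induction with
    | mem z hz =>
      obtain ⟨t, _, rfl⟩ := hz
      exact Submodule.subset_span ⟨t, rfl⟩
    | zero => simp
    | add u v _ _ hu hv => rw [map_add]; exact add_mem (hu trivial) (hv trivial)
    | smul s u _ hu => rw [h.apply_smul]; exact Submodule.smul_mem _ _ (hu trivial)
  · rw [hxy.finrank_eq]
    simp

end Deformation

/-! ### Consequences of a cellular basis: free standard modules, central characters, a filtration.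
-/

section Cellular

variable {I : Type*} [Fintype I] [PartialOrder I] {S : Type*} [CommRing S]
  {B : Type*} [Ring B] [Algebra S B] {e : I → B} {n : I → ℕ} {x y : ∀ α, Fin (n α) → B}

theorem IsCellularBasis.mul_idem_mul_mem (h : IsCellularBasis S e n x y) (α : I) (b c : B) :
    b * e α * c ∈ cellSpan S x y (Set.Ici α) :=
  mul_idem_mul_mem_cellSpan h.idempotents h.left_span h.right_span α b c

theorem IsCellularBasis.mul_mul_mem_cellSpan (h : IsCellularBasis S e n x y) {Γ : Set I}
    (hΓ : IsUpperSet Γ) {z : B} (hz : z ∈ cellSpan S x y Γ) (b c : B) :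
    b * z * c ∈ cellSpan S x y Γ := by
  induction hz using Submodule.span_induction with
  | zero => simp
  | add u v _ _ hu hv => rw [mul_add, add_mul]; exact add_mem hu hv
  | smul s u _ hu => rw [mul_smul_comm, smul_mul_assoc]; exact Submodule.smul_mem _ _ hu
  | mem z hz =>
    obtain ⟨⟨α, i, j⟩, hα, rfl⟩ := hz
    have := h.mul_idem_mul_mem α (b * x α i) (y α j * c)
    rw [mul_assoc b, h.left_mul] at this
    rw [← mul_assoc, mul_assoc]
    exact cellSpan_mono x y (hΓ.Ici_subset hα) (by simpa only [mul_assoc] using this)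

/-- The cellular basis as a basis. -/
def IsCellularBasis.basis (h : IsCellularBasis S e n x y) :
    Module.Basis (Σ α, Fin (n α) × Fin (n α)) S B :=
  Module.Basis.mk h.linearIndependent (by
    have := cellSpan_univ h.idempotents h.left_span h.right_span
    rw [cellSpan] at this
    simpa using this.ge)

theorem IsCellularBasis.basis_apply (h : IsCellularBasis S e n x y) (α : I) (i j : Fin (n α)) :
    h.basis ⟨α, i, j⟩ = x α i * y α j := by
  rw [IsCellularBasis.basis, Module.Basis.mk_apply]

theorem IsCellularBasis.repr_eq_zero (h : IsCellularBasis S e n x y) {Γ : Set I} {z : B}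
    (hz : z ∈ cellSpan S x y Γ) {α : I} (hα : α ∉ Γ) (i j : Fin (n α)) :
    h.basis.repr z ⟨α, i, j⟩ = 0 := by
  have h1 : cellSpan S x y Γ = Submodule.span S (h.basis '' {t | t.1 ∈ Γ}) := by
    rw [cellSpan]
    congr 2
    funext t
    exact (h.basis_apply t.1 t.2.1 t.2.2).symm
  rw [h1, Module.Basis.mem_span_image] at hz
  by_contra hne
  exact hα (hz (Finsupp.mem_support_iff.2 hne))

theorem IsCellularBasis.kerProjToStd_le (h : IsCellularBasis S e n x y) (α : I) {z : B}
    (hz : z ∈ kerProjToStd e α) : z ∈ cellSpan S x y {γ | ¬ γ ≤ α} := by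
  have hup : IsUpperSet {γ | ¬ γ ≤ α} := fun a b hab ha hb => ha (hab.trans hb)
  induction hz using Submodule.span_induction with
  | zero => simp
  | add u v _ _ hu hv => exact add_mem hu hv
  | smul b u _ hu =>
    have := h.mul_mul_mem_cellSpan hup hu 1 (unop b)
    rwa [one_mul] at this
  | mem z hz =>
    obtain ⟨a, rfl⟩ := hz
    rw [eps, Finset.mul_sum]
    refine sum_mem fun γ _ => ?_
    split_ifs with hγ
    · simp
    · have h1 := h.mul_idem_mul_mem γ (e α * a) 1
      rw [mul_one] at h1
      exact cellSpan_mono x y (hup.Ici_subset hγ) h1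

/-- Multiplying on the left by one `x α i`, available since `n α > 0`, turns the combination into
basis elements of the cell `α`, while the product lies in cells `γ ≰ α`. Comparing coordinates gives
`s = 0`. -/
theorem IsCellularBasis.sum_smul_eq_zero (h : IsCellularBasis S e n x y) {α : I}
    {s : Fin (n α) → S} (hs : ∑ j, s j • y α j ∈ kerProjToStd e α) : s = 0 := by
  classical
  have hup : IsUpperSet {γ | ¬ γ ≤ α} := fun a b hab ha hb => ha (hab.trans hb)
  funext j
  let i : Fin (n α) := ⟨0, h.pos α⟩
  have h1 := h.mul_mul_mem_cellSpan hup (h.kerProjToStd_le α hs) (x α i) 1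
  have h2 := h.repr_eq_zero h1 (α := α) (fun hn => hn le_rfl) i j
  rw [mul_one, Finset.mul_sum, map_sum, Finsupp.finsetSum_apply] at h2
  rw [Finset.sum_eq_single j] at h2
  · rwa [mul_smul_comm, ← h.basis_apply, map_smul, Module.Basis.repr_self, Finsupp.smul_apply,
      Finsupp.single_eq_same, smul_eq_mul, mul_one] at h2
  · intro k _ hk
    rw [mul_smul_comm, ← h.basis_apply, map_smul, Module.Basis.repr_self, Finsupp.smul_apply,
      Finsupp.single_eq_of_ne, smul_zero]
    intro heq
    simp only [Sigma.mk.injEq, heq_eq_eq, true_and, Prod.mk.injEq] at heq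
    exact hk heq.symm
  · simp

theorem exists_eq_sum_add_of_mem_span_union {M ι : Type*} [AddCommGroup M] [Module S M] [Fintype ι]
    {v : ι → M} {T : Set M} {z : M} (hz : z ∈ Submodule.span S (Set.range v ∪ T)) :
    ∃ (s : ι → S), ∃ t ∈ Submodule.span S T, z = ∑ j, s j • v j + t := by
  rw [Submodule.span_union] at hz
  obtain ⟨w, hw, t, ht, rfl⟩ := Submodule.mem_sup.1 hz
  obtain ⟨s, rfl⟩ := (Submodule.mem_span_range_iff_exists_fun S).1 hw
  exact ⟨s, t, ht, rfl⟩

theorem span_above_le_kerProjToStd (he : CompleteOrthogonalIdempotents e) {α : I} {t : B}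
    (ht : t ∈ Submodule.span S {z | ∃ δ, α < δ ∧ ∃ b c, z = e α * b * e δ * c}) :
    t ∈ kerProjToStd e α := by
  have : Submodule.span S {z | ∃ δ, α < δ ∧ ∃ b c, z = e α * b * e δ * c} ≤
      (kerProjToStd e α).restrictScalars S := by
    rw [Submodule.span_le]
    rintro _ ⟨δ, hδ, b, c, rfl⟩
    exact mul_idem_mul_mem_kerProjToStd he hδ.not_ge b c
  exact this ht

/-- This sharpens `γ ≰ α` to `γ > α`, discarding incomparable labels: the part of `z` along the `y α
j` vanishes by `sum_smul_eq_zero`. The filtration by levels depends on it. -/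
theorem IsCellularBasis.kerProjToStd_le_above (h : IsCellularBasis S e n x y) (α : I) {z : B}
    (hz : z ∈ kerProjToStd e α) : z ∈ cellSpan S x y (Set.Ioi α) := by
  have h1 := h.right_span α z
  rw [(mem_proj_iff h.idempotents).1 (kerProjToStd_le_proj h.idempotents α hz)] at h1
  obtain ⟨s, t, ht, rfl⟩ := exists_eq_sum_add_of_mem_span_union h1
  have h2 := span_above_le_kerProjToStd h.idempotents ht
  have h3 : s = 0 := h.sum_smul_eq_zero (by simpa using sub_mem hz h2)
  subst h3
  have h4 : Submodule.span S {z | ∃ δ, α < δ ∧ ∃ b c, z = e α * b * e δ * c} ≤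
      cellSpan S x y (Set.Ioi α) := by
    rw [Submodule.span_le]
    rintro _ ⟨δ, hδ, b, c, rfl⟩
    exact cellSpan_mono x y (Set.Ici_subset_Ioi.2 hδ) (h.mul_idem_mul_mem δ _ _)
  simpa using h4 ht

variable (S e) in
/-- The map from the algebra to a standard module given by the action on the generator. -/
def toStd (α : I) : B →ₗ[S] Std e α where
  toFun b := op b • Std.gen e α
  map_add' b c := by rw [op_add, add_smul]
  map_smul' s b := by rw [op_smul, smul_assoc, RingHom.id_apply]

theorem toStd_apply (α : I) (b : B) : toStd S e α b = op b • Std.gen e α := rfl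

theorem toStd_surjective (α : I) : Function.Surjective (toStd S e α) := fun v => by
  obtain ⟨b, rfl⟩ := Std.exists_gen_smul α v
  exact ⟨b, rfl⟩

theorem toStd_idem_mul (he : CompleteOrthogonalIdempotents e) (α : I) (b : B) :
    toStd S e α (e α * b) = toStd S e α b := by
  rw [toStd_apply, op_mul, mul_smul, Std.gen_smul_self he, toStd_apply]

theorem toStd_eq_zero_of_mem (he : CompleteOrthogonalIdempotents e) {α : I} {b : B}
    (hb : b ∈ kerProjToStd e α) : toStd S e α b = 0 := by
  rw [toStd_apply, Std.gen_smul_eq_zero_iff,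
    (mem_proj_iff he).1 (kerProjToStd_le_proj he α hb)]
  exact hb

/-- The basis of the standard module given by a cellular basis. -/
def IsCellularBasis.stdBasis (h : IsCellularBasis S e n x y) (α : I) :
    Module.Basis (Fin (n α)) S (Std e α) :=
  Module.Basis.mk (v := fun j => toStd S e α (y α j))
    (by
      rw [Fintype.linearIndependent_iff]
      intro s hs
      simp_rw [← map_smul] at hs
      rw [← map_sum, toStd_apply, Std.gen_smul_eq_zero_iff, Finset.mul_sum] at hs
      simp_rw [mul_smul_comm, h.right_mul] at hs
      exact fun i => congrFun (h.sum_smul_eq_zero hs) i)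
    (by
      intro v _
      obtain ⟨b, rfl⟩ := toStd_surjective (S := S) α v
      obtain ⟨s, t, ht, hb⟩ := exists_eq_sum_add_of_mem_span_union (h.right_span α b)
      rw [← toStd_idem_mul h.idempotents, hb, map_add, map_sum,
        toStd_eq_zero_of_mem h.idempotents (span_above_le_kerProjToStd h.idempotents ht), add_zero]
      refine sum_mem fun j _ => ?_
      rw [map_smul]
      exact Submodule.smul_mem _ _ (Submodule.subset_span ⟨j, rfl⟩))

theorem IsCellularBasis.stdBasis_apply (h : IsCellularBasis S e n x y) (α : I) (j : Fin (n α)) :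
    h.stdBasis α j = toStd S e α (y α j) := by
  rw [IsCellularBasis.stdBasis, Module.Basis.mk_apply]

theorem IsCellularBasis.gen_ne_zero [Nontrivial S] (h : IsCellularBasis S e n x y) (α : I) :
    Std.gen e α ≠ 0 := by
  intro h0
  have := (h.stdBasis α).ne_zero ⟨0, h.pos α⟩
  rw [h.stdBasis_apply, toStd_apply, h0, smul_zero] at this
  exact this rfl

/-! ### Central characters -/

theorem IsCellularBasis.exists_smul_gen (h : IsCellularBasis S e n x y) (α : I) (a : B) :
    ∃ c : S, op (e α * a * e α) • Std.gen e α = c • Std.gen e α := by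
  have h1 := h.diag_span α a
  rw [show ({e α} : Set B) = Set.range (fun _ : Unit => e α) by simp] at h1
  obtain ⟨s, t, ht, hb⟩ := exists_eq_sum_add_of_mem_span_union h1
  refine ⟨s (), ?_⟩
  have ht' : t ∈ kerProjToStd e α := by
    refine span_above_le_kerProjToStd (S := S) h.idempotents (Submodule.span_mono ?_ ht)
    rintro _ ⟨δ, hδ, b, c, rfl⟩
    exact ⟨δ, hδ, b, c * e α, by simp only [mul_assoc]⟩
  have h2 : toStd S e α (e α * a * e α) = s () • toStd S e α (e α) := by
    rw [hb, map_add, toStd_eq_zero_of_mem h.idempotents ht', add_zero]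
    simp
  rwa [toStd_apply, toStd_apply, Std.gen_smul_self h.idempotents] at h2

/-- On the generator, `ζ` acts as `e α * ζ * e α`, hence by a scalar. Being central, it acts by the
same scalar on everything the generator generates. -/
theorem IsCellularBasis.exists_central_smul (h : IsCellularBasis S e n x y) (α : I)
    (ζ : Subalgebra.center S B) : ∃ c : S, ∀ v : Std e α, op (ζ : B) • v = c • v := by
  obtain ⟨c, hc⟩ := h.exists_smul_gen α (ζ : B)
  have hζ : ∀ b : B, b * ζ = ζ * b := Subalgebra.mem_center_iff.1 ζ.2
  refine ⟨c, fun v => ?_⟩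
  obtain ⟨b, rfl⟩ := Std.exists_gen_smul α v
  have h1 : op (ζ : B) • Std.gen e α = c • Std.gen e α := by
    rw [← hc, hζ, mul_assoc, (h.idempotents.idem α).eq, ← hζ, op_mul, mul_smul,
      Std.gen_smul_self h.idempotents]
  rw [smul_smul, ← op_mul, hζ, op_mul, mul_smul, h1, smul_comm]

theorem IsCellularBasis.existsUnique_character [IsDomain S] (h : IsCellularBasis S e n x y) :
    ∃! χ : I → (Subalgebra.center S B →ₐ[S] S), ∀ α, IsCentralCharacter e α (χ α) := by
  choose c hc using h.exists_central_smul
  have hfree : ∀ α, Module.Free S (Std e α) := fun α => Module.Free.of_basis (h.stdBasis α)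
  -- Standard modules are free and their generators nonzero, so the scalar is determined by its
  -- effect on the generator; every homomorphism axiom follows from this.
  have huniq : ∀ α (s t : S), s • Std.gen e α = t • Std.gen e α → s = t := fun α s t hst =>
    smul_left_injective S (h.gen_ne_zero α) hst
  refine ⟨fun α => AlgHom.ofLinearMap ⟨⟨c α, fun ζ ξ => huniq α _ _ ?_⟩,
    fun s ζ => huniq α _ _ ?_⟩ (huniq α _ _ ?_) fun ζ ξ => huniq α _ _ ?_, fun α ζ v => hc α ζ v,
    fun χ hχ => ?_⟩
  · rw [← hc, add_smul, ← hc, ← hc, ← add_smul, ← op_add]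
    rfl
  · rw [← hc, RingHom.id_apply, smul_eq_mul, mul_smul, ← hc, ← smul_assoc, ← op_smul]
    rfl
  · change c α 1 • _ = _
    rw [← hc, one_smul]
    exact one_smul Bᵐᵒᵖ _
  · change c α (ζ * ξ) • _ = (c α ζ * c α ξ) • _
    rw [← hc, mul_smul, ← hc, ← hc, smul_smul, ← op_mul]
    congr 2
    exact (Subalgebra.mem_center_iff.1 ξ.2 _)
  · funext α
    ext ζ
    exact huniq α _ _ ((hχ α ζ _).symm.trans (hc α ζ _))

/-! ### Existence of a deformed standard filtration -/

/-- The right ideal spanned by the elements of a cellular basis with labels in an upper set. -/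
def IsCellularBasis.rightIdeal (h : IsCellularBasis S e n x y) {Γ : Set I} (hΓ : IsUpperSet Γ) :
    Submodule Bᵐᵒᵖ B where
  toAddSubmonoid := (cellSpan S x y Γ).toAddSubmonoid
  smul_mem' b z hz := by
    have := h.mul_mul_mem_cellSpan hΓ hz 1 (unop b)
    rwa [one_mul] at this

/-- Left multiplication by an element, as a map from a standard module to a subquotient of the
algebra. -/
theorem exists_std_hom {α : I} {P Q : Submodule Bᵐᵒᵖ B} {w : B} (hP : w * e α ∈ P)
    (hQ : ∀ z ∈ kerProjToStd e α, w * z ∈ Q) :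
    ∃ f : Std e α →ₗ[Bᵐᵒᵖ] P ⧸ Q.submoduleOf P, ∀ b : B, ∃ hb : w * e α * b ∈ P,
      f (op b • Std.gen e α) = Submodule.Quotient.mk ⟨w * e α * b, hb⟩ := by
  have hPb : ∀ b, w * e α * b ∈ P := fun b => P.smul_mem (op b) hP
  have hmem : ∀ z ∈ proj e α, w * z ∈ P := fun z hz => by
    obtain ⟨b, rfl⟩ := Submodule.mem_span_singleton.1 hz
    rw [← op_unop b, op_smul_eq_mul, ← mul_assoc]
    exact hPb _
  let g : proj e α →ₗ[Bᵐᵒᵖ] P :=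
    { toFun := fun z => ⟨w * z, hmem z z.2⟩
      map_add' := fun z z' => Subtype.ext (mul_add _ _ _)
      map_smul' := fun b z => Subtype.ext (mul_assoc w (z : B) (unop b)).symm }
  refine ⟨Submodule.mapQ _ _ g fun z hz => hQ _ hz, fun b => ⟨hPb b, ?_⟩⟩
  rw [Std.gen, ← Submodule.Quotient.mk_smul]
  change Submodule.Quotient.mk (g _) = _
  congr 1
  exact Subtype.ext (mul_assoc w (e α) b).symm

theorem IsCellularBasis.exists_filtration (h : IsCellularBasis S e n x y) :
    ∃ m F, IsDeformedStandardFiltration e m F := by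
  classical
  -- The level, the number of labels strictly above, drops strictly when going up, so `lev < k` cuts
  -- out an upper set. Step `k` of the filtration adds the cells of level `k`, each contributing `n
  -- α` copies of its standard module.
  let lev : I → ℕ := fun α => (Finset.univ.filter (α < ·)).card
  have hlev : ∀ α β, α < β → lev β < lev α := fun α β hαβ => by
    refine Finset.card_lt_card ⟨fun γ hγ => ?_, fun hsub => ?_⟩
    · simp only [Finset.mem_filter, Finset.mem_univ, true_and] at hγ ⊢
      exact hαβ.trans hγ
    · have : β ∈ Finset.univ.filter (β < ·) := hsub (by simpa using hαβ)
      simp at this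
  have hup : ∀ k, IsUpperSet {γ | lev γ < k} := fun k a b hab ha => by
    rcases hab.eq_or_lt with rfl | hlt
    · exact ha
    · exact lt_trans (hlev _ _ hlt) ha
  let F : ℕ → Submodule Bᵐᵒᵖ B := fun k => h.rightIdeal (hup k)
  let mult : ℕ → I → ℕ := fun k α => if lev α = k then n α else 0
  have hmult : ∀ k α (i : Fin (mult k α)), lev α = k ∧ (i : ℕ) < n α := fun k α i => by
    have := i.2
    simp only [mult] at this
    split_ifs at this with hk
    · exact ⟨hk, this⟩
    · omega
  refine ⟨Fintype.card I + 1, F, ?_, ?_, ?_, mult, ?_, ?_⟩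
  · exact fun k l hkl => cellSpan_mono x y fun γ (hγ : lev γ < k) => lt_of_lt_of_le hγ hkl
  · rw [eq_bot_iff]
    intro z hz
    have hz' : z ∈ cellSpan S x y {γ | lev γ < 0} := hz
    rw [cellSpan] at hz'
    simpa using hz'
  · rw [← top_le_iff]
    intro z _
    have hz : z ∈ cellSpan S x y Set.univ := by
      rw [cellSpan_univ h.idempotents h.left_span h.right_span]; trivial
    exact cellSpan_mono x y (fun γ _ => Nat.lt_succ_of_le (Finset.card_le_univ _)) hz
  · intro k _
    have hF1 : ∀ α (i : Fin (mult k α)), x α ⟨i, (hmult k α i).2⟩ * e α ∈ F (k + 1) := by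
      intro α i
      have h1 := h.mul_idem_mul_mem α (x α ⟨i, (hmult k α i).2⟩) 1
      rw [mul_one] at h1
      refine cellSpan_mono x y ?_ h1
      refine (hup (k + 1)).Ici_subset ?_
      exact (hmult k α i).1 ▸ Nat.lt_succ_self _
    -- Labels strictly above a label of level `k` have level below `k`, so left multiplication by `x
    -- α i` sends the kernel into `F k` and descends to the standard module.
    have hF2 : ∀ α (i : Fin (mult k α)), ∀ z ∈ kerProjToStd e α,
        x α ⟨i, (hmult k α i).2⟩ * z ∈ F k := by
      intro α i z hz
      have h1 : z ∈ cellSpan S x y {γ | lev γ < k} :=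
        cellSpan_mono x y (fun γ hγ => by
          have := hlev α γ hγ
          rwa [(hmult k α i).1] at this) (h.kerProjToStd_le_above α hz)
      have h2 := h.mul_mul_mem_cellSpan (hup k) h1 (x α ⟨i, (hmult k α i).2⟩) 1
      rwa [mul_one] at h2
    choose ψ hψm hψ using fun α (i : Fin (mult k α)) => exists_std_hom (hF1 α i) (hF2 α i)
    let Φ : (∀ α : I, Fin (mult k α) → Std e α) →ₗ[Bᵐᵒᵖ]
        (F (k + 1) ⧸ (F k).submoduleOf (F (k + 1))) :=
      ∑ α, ∑ i, ψ α i ∘ₗ LinearMap.proj i ∘ₗ LinearMap.proj α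
    have hΦ : ∀ v, Φ v = ∑ α, ∑ i, ψ α i (v α i) := fun v => by
      simp [Φ]
    let q := ((F k).submoduleOf (F (k + 1))).mkQ
    have hψq : ∀ α (i : Fin (mult k α)) b, ∃ hb : x α ⟨i, (hmult k α i).2⟩ * b ∈ F (k + 1),
        ψ α i (op b • Std.gen e α) = q ⟨x α ⟨i, (hmult k α i).2⟩ * b, hb⟩ := by
      intro α i b
      have h1 := hψ α i b
      have h2 := hψm α i b
      simp only [h.left_mul] at h1 h2
      exact ⟨h2, h1⟩
    refine ⟨(LinearEquiv.ofBijective Φ ⟨?_, ?_⟩).symm⟩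
    · suffices hinj : ∀ v, Φ v = 0 → v = 0 by
        intro v v' hvv'
        rw [← sub_eq_zero]
        exact hinj _ ((LinearMap.map_sub Φ v v').trans (sub_eq_zero.2 hvv'))
      intro v hv
      let s : ∀ α, Fin (mult k α) → Fin (n α) → S := fun α i j => (h.stdBasis α).repr (v α i) j
      let w : ∀ α, Fin (mult k α) → B := fun α i => ∑ j, s α i j • y α j
      have hvw : ∀ α i, v α i = op (w α i) • Std.gen e α := by
        intro α i
        conv_lhs => rw [← (h.stdBasis α).sum_repr (v α i)]
        rw [← toStd_apply (S := S), map_sum]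
        simp only [map_smul, h.stdBasis_apply]
        rfl
      choose hm hq using fun α i => hψq α i (w α i)
      rw [hΦ] at hv
      simp_rw [hvw, hq, ← map_sum] at hv
      have h3 := (Submodule.Quotient.mk_eq_zero _).1 hv
      have h4 : ∑ α, ∑ i : Fin (mult k α), x α ⟨i, (hmult k α i).2⟩ * w α i ∈
          cellSpan S x y {γ | lev γ < k} := by
        have : ((∑ α, ∑ i : Fin (mult k α), (⟨x α ⟨i, (hmult k α i).2⟩ * w α i, hm α i⟩ : F (k + 1)) :
            F (k + 1)) : B) ∈ F k := h3
        simp only [AddSubmonoidClass.coe_finsetSum] at this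
        exact this
      have hs : ∀ α i j, s α i j = 0 := by
        intro α i j
        have h5 := h.repr_eq_zero h4 (α := α)
          (by simp [(hmult k α i).1]) ⟨i, (hmult k α i).2⟩ j
        simp only [w, Finset.mul_sum, mul_smul_comm, ← h.basis_apply, map_sum, map_smul,
          Module.Basis.repr_self, Finsupp.finsetSum_apply, Finsupp.smul_apply,
          smul_eq_mul] at h5
        rw [Finset.sum_eq_single α, Finset.sum_eq_single i, Finset.sum_eq_single j] at h5
        · rwa [Finsupp.single_eq_same, mul_one] at h5
        · intro j' _ hj'
          rw [Finsupp.single_eq_of_ne, mul_zero]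
          intro heq
          simp only [Sigma.mk.injEq, heq_eq_eq, true_and, Prod.mk.injEq] at heq
          exact hj' heq.symm
        · simp
        · intro i' _ hi'
          refine Finset.sum_eq_zero fun j' _ => ?_
          rw [Finsupp.single_eq_of_ne, mul_zero]
          intro heq
          simp only [Sigma.mk.injEq, heq_eq_eq, true_and, Prod.mk.injEq, Fin.mk.injEq] at heq
          exact hi' (Fin.ext heq.1.symm)
        · simp
        · intro α' _ hα'
          refine Finset.sum_eq_zero fun i' _ => Finset.sum_eq_zero fun j' _ => ?_
          rw [Finsupp.single_eq_of_ne, mul_zero]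
          intro heq
          exact hα' (congrArg Sigma.fst heq).symm
        · simp
      funext α i
      rw [hvw]
      simp [w, hs]
    · intro z
      obtain ⟨⟨z, hz⟩, rfl⟩ := Submodule.mkQ_surjective _ z
      have hz' : z ∈ cellSpan S x y {γ | lev γ < k + 1} := hz
      have hrange : ∀ z ∈ cellSpan S x y {γ | lev γ < k + 1}, ∃ hz : z ∈ F (k + 1),
          q ⟨z, hz⟩ ∈ LinearMap.range Φ := by
        intro z hz
        induction hz using Submodule.span_induction with
        | zero => exact ⟨zero_mem _, ⟨0, by rw [map_zero]; exact (map_zero q).symm⟩⟩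
        | add u v _ _ hu hv =>
          obtain ⟨hu, hu'⟩ := hu
          obtain ⟨hv, hv'⟩ := hv
          exact ⟨add_mem hu hv, add_mem hu' hv'⟩
        | smul s u _ hu =>
          obtain ⟨hu, hu'⟩ := hu
          exact ⟨Submodule.smul_of_tower_mem _ s hu, Submodule.smul_of_tower_mem _ s hu'⟩
        | mem z hz =>
          obtain ⟨⟨α, i, j⟩, hα, rfl⟩ := hz
          have hmem : x α i * y α j ∈ F (k + 1) := mul_mem_cellSpan x y hα i j
          refine ⟨hmem, ?_⟩
          by_cases hk : lev α = k
          · let i' : Fin (mult k α) := ⟨i, by simp [mult, hk]⟩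
            refine ⟨Pi.single α (Pi.single i' (op (y α j) • Std.gen e α)), ?_⟩
            rw [hΦ, Finset.sum_eq_single α, Finset.sum_eq_single i']
            · rw [Pi.single_eq_same, Pi.single_eq_same]
              exact (hψq α i' (y α j)).2
            · intro i'' _ hi''
              rw [Pi.single_eq_same, Pi.single_eq_of_ne hi'', map_zero]
            · simp
            · intro β _ hβ
              refine Finset.sum_eq_zero fun i'' _ => ?_
              rw [Pi.single_eq_of_ne hβ, Pi.zero_apply, map_zero]
            · simp
          · have : q ⟨x α i * y α j, hmem⟩ = 0 := by
              refine (Submodule.Quotient.mk_eq_zero _).2 ?_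
              exact mul_mem_cellSpan x y
                (show lev α < k from lt_of_le_of_ne (Nat.lt_succ_iff.1 hα) hk) i j
            dsimp only
            rw [this]
            exact zero_mem _
      exact (hrange z hz').2
  · intro k _ α
    by_cases hk : lev α = k
    · right; simp [mult, hk]
    · left; simp [mult, hk]

end Cellular

/-! ### Elements killing standard modules, and separation by central characters. -/

section Faithful

variable {I : Type*} [Fintype I] [PartialOrder I] {S : Type*} [CommRing S]
  {B : Type*} [Ring B] [Algebra S B] {e : I → B}

/-- The element `b` acts by zero on all standard modules. -/
def KillsStd (e : I → B) (b : B) : Prop := ∀ α (v : Std e α), op b • v = 0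

theorem IsDeformedStandardFiltration.mul_mem {m : ℕ} {F : ℕ → Submodule Bᵐᵒᵖ B}
    (hF : IsDeformedStandardFiltration e m F) {b : B} (hb : KillsStd e b) {k : ℕ} (hk : k < m)
    {f : B} (hf : f ∈ F (k + 1)) : f * b ∈ F k := by
  obtain ⟨_, _, _, mult, hq, _⟩ := hF
  obtain ⟨φ⟩ := hq k hk
  have h1 : op b • (Submodule.Quotient.mk ⟨f, hf⟩ :
      F (k + 1) ⧸ (F k).submoduleOf (F (k + 1))) = 0 := by
    apply φ.injective
    rw [map_smul, map_zero]
    funext α i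
    exact hb α _
  rw [← Submodule.Quotient.mk_smul, Submodule.Quotient.mk_eq_zero] at h1
  exact h1

theorem IsDeformedStandardFiltration.pow_eq_zero {m : ℕ} {F : ℕ → Submodule Bᵐᵒᵖ B}
    (hF : IsDeformedStandardFiltration e m F) {b : B} (hb : KillsStd e b) : b ^ m = 0 := by
  have key : ∀ k ≤ m, ∀ f ∈ F k, f * b ^ k = 0 := by
    intro k
    induction k with
    | zero =>
      intro _ f hf
      rw [hF.2.1, Submodule.mem_bot] at hf
      rw [hf, zero_mul]
    | succ k ih =>
      intro hk f hf
      rw [pow_succ', ← mul_assoc]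
      exact ih (by omega) _ (hF.mul_mem hb (by omega) hf)
  have := key m le_rfl 1 (by rw [hF.2.2.1]; trivial)
  rwa [one_mul] at this

variable (e) in
/-- The submodule generated by the vectors of the form `v e_α`. -/
def idemSpan (α : I) (N : Type*) [AddCommMonoid N] [Module Bᵐᵒᵖ N] : Submodule Bᵐᵒᵖ N :=
  Submodule.span Bᵐᵒᵖ {x | ∃ y, x = op (e α) • y}

theorem map_idemSpan_le (α : I) {N N' : Type*} [AddCommMonoid N] [Module Bᵐᵒᵖ N]
    [AddCommMonoid N'] [Module Bᵐᵒᵖ N'] (f : N →ₗ[Bᵐᵒᵖ] N') :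
    (idemSpan e α N).map f ≤ idemSpan e α N' := by
  rw [idemSpan, Submodule.map_span, Submodule.span_le]
  rintro _ ⟨_, ⟨y, rfl⟩, rfl⟩
  exact Submodule.subset_span ⟨f y, map_smul _ _ _⟩

theorem map_idemSpan_of_surjective (α : I) {N N' : Type*} [AddCommMonoid N] [Module Bᵐᵒᵖ N]
    [AddCommMonoid N'] [Module Bᵐᵒᵖ N'] (f : N →ₗ[Bᵐᵒᵖ] N') (hf : Function.Surjective f) :
    (idemSpan e α N).map f = idemSpan e α N' := by
  refine le_antisymm (map_idemSpan_le α f) ?_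
  rw [idemSpan, idemSpan, Submodule.map_span, Submodule.span_le]
  rintro _ ⟨y, rfl⟩
  obtain ⟨y, rfl⟩ := hf y
  exact Submodule.subset_span ⟨_, ⟨y, rfl⟩, map_smul _ _ _⟩

/-- On each layer `q` leaves only the copies of the standard module of `α`, which are generated by
vectors fixed by `e α`. So each factor of `q` lowers the filtration by one step at the cost of a
term in the two-sided ideal of `e α`. -/
theorem pow_mem_span_of_filtration {m : ℕ} {F : ℕ → Submodule Bᵐᵒᵖ B}
    (he : CompleteOrthogonalIdempotents e)
    (hF : IsDeformedStandardFiltration e m F) {α : I} {q : B}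
    (hqz : ∀ β, β ≠ α → ∀ v : Std e β, op q • v = 0) :
    q ^ m ∈ AddSubgroup.closure {z | ∃ a b, z = a * e α * b} := by
  classical
  set J := AddSubgroup.closure {z | ∃ a b, z = a * e α * b} with hJ
  have hJmul : ∀ z ∈ J, ∀ b, z * b ∈ J := by
    intro z hz b
    induction hz using AddSubgroup.closure_induction with
    | mem z hz =>
      obtain ⟨a, c, rfl⟩ := hz
      exact AddSubgroup.subset_closure ⟨a, c * b, mul_assoc _ _ _⟩
    | zero => simp
    | add u v _ _ hu hv => rw [add_mul]; exact add_mem hu hv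
    | neg u _ hu => rw [neg_mul]; exact neg_mem hu
  have hspanJ : ∀ z ∈ idemSpan e α B, z ∈ J := by
    intro z hz
    induction hz using Submodule.span_induction with
    | mem z hz =>
      obtain ⟨y, rfl⟩ := hz
      exact AddSubgroup.subset_closure ⟨y, 1, by rw [mul_one]; rfl⟩
    | zero => exact zero_mem _
    | add u v _ _ hu hv => exact add_mem hu hv
    | smul b u _ hu => exact hJmul _ hu (unop b)
  have key : ∀ k ≤ m, ∀ f ∈ F k, f * q ^ k ∈ J := by
    intro k
    induction k with
    | zero =>
      intro _ f hf
      rw [hF.2.1, Submodule.mem_bot] at hf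
      rw [hf, zero_mul]
      exact zero_mem _
    | succ k ih =>
      intro hk f hf
      obtain ⟨_, _, _, mult, hφ, _⟩ := hF
      obtain ⟨φ⟩ := hφ k hk
      have hpi : ∀ v : (∀ β : I, Fin (mult k β) → Std e β),
          op q • v ∈ idemSpan e α (∀ β : I, Fin (mult k β) → Std e β) := by
        intro v
        have hv : op q • v = ∑ i, LinearMap.single Bᵐᵒᵖ _ α
            (LinearMap.single Bᵐᵒᵖ _ i (op q • v α i)) := by
          rw [← map_sum]
          funext β
          by_cases hβ : β = α
          · subst hβ
            rw [LinearMap.single_apply, Pi.single_eq_same]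
            exact (LinearMap.sum_single_apply (fun _ => Std e β) (fun i => op q • v β i)).symm
          · rw [LinearMap.single_apply, Pi.single_eq_of_ne hβ]
            funext i
            exact hqz β hβ _
        rw [hv]
        refine sum_mem fun i _ => ?_
        refine map_idemSpan_le α (LinearMap.single Bᵐᵒᵖ _ α) (Submodule.mem_map_of_mem ?_)
        refine map_idemSpan_le α (LinearMap.single Bᵐᵒᵖ _ i) (Submodule.mem_map_of_mem ?_)
        rw [idemSpan, Std.span_weight_eq_top he]
        trivial
      let π := ((F k).submoduleOf (F (k + 1))).mkQ
      have h1 : π (op q • ⟨f, hf⟩) ∈ idemSpan e α _ := by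
        have h2 := map_idemSpan_le α φ.symm.toLinearMap
          (Submodule.mem_map_of_mem (hpi (φ (π ⟨f, hf⟩))))
        have h3 : φ.symm (op q • φ (π ⟨f, hf⟩)) = π (op q • ⟨f, hf⟩) := by
          rw [LinearEquiv.map_smul, LinearEquiv.symm_apply_apply, map_smul]
        rw [← h3]
        exact h2
      rw [← map_idemSpan_of_surjective α π (Submodule.mkQ_surjective _)] at h1
      obtain ⟨g, hg, hgf⟩ := h1
      -- Here `g` comes from the ideal of `e α`, so `f * q ^ (k + 1) = (f * q - g) * q ^ k + g * q ^
      -- k` has both terms in `J`.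
      have h3 : f * q - g ∈ F k := by
        have h4 : π (op q • ⟨f, hf⟩ - g) = 0 := by rw [map_sub, hgf, sub_self]
        exact (Submodule.Quotient.mk_eq_zero ((F k).submoduleOf (F (k + 1)))).1 h4
      have hgJ : (g : B) ∈ J := by
        exact hspanJ _ (map_idemSpan_le α (F (k + 1)).subtype (Submodule.mem_map_of_mem hg))
      have h6 := add_mem (ih (by omega) _ h3) (hJmul _ hgJ (q ^ k))
      rwa [← add_mul, sub_add_cancel, mul_assoc, ← pow_succ'] at h6
  have := key m le_rfl 1 (by rw [hF.2.2.1]; trivial)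
  rwa [one_mul] at this

/-- A central element that acts by zero on all but one of the standard modules has a power that
annihilates the elements acting by zero on the remaining one. -/
theorem pow_mul_eq_zero_of_filtration {m : ℕ} {F : ℕ → Submodule Bᵐᵒᵖ B}
    (he : CompleteOrthogonalIdempotents e)
    (hF : IsDeformedStandardFiltration e m F) {α : I} {q : B} (hq : ∀ b, b * q = q * b)
    (hqz : ∀ β, β ≠ α → ∀ v : Std e β, op q • v = 0) {x : B} (hx : ∀ v : Std e α, op x • v = 0) :
    q ^ (2 * m + 1) * x = 0 := by
  have hqpow : ∀ k b, b * q ^ k = q ^ k * b := fun k b => ((show Commute b q from hq b).pow_right k).eq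
  -- The product `q * e γ` kills every standard module, so it is nilpotent. The exponent is `m + 1`
  -- because `e γ` equals only its positive powers, and `m` may be zero.
  have hqe : ∀ γ, ¬ γ ≤ α → q ^ (m + 1) * e γ = 0 := by
    intro γ hγ
    have hk : KillsStd e (q * e γ) := by
      intro β v
      by_cases hβ : β = α
      · subst hβ
        rw [← hq, op_mul, mul_smul, Std.smul_eq_zero_of_not_le he hγ, smul_zero]
      · rw [op_mul, mul_smul, hqz β hβ, smul_zero]
    have h1 := hF.pow_eq_zero hk
    have h2 : (q * e γ) ^ (m + 1) = 0 := by rw [pow_succ, h1, zero_mul]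
    rwa [(show Commute q (e γ) from (hq (e γ)).symm).mul_pow,
      (he.idem γ).pow_succ_eq] at h2
  have hker : ∀ z ∈ kerProjToStd e α, q ^ (m + 1) * z = 0 := by
    intro z hz
    induction hz using Submodule.span_induction with
    | zero => simp
    | add u v _ _ hu hv => rw [mul_add, hu, hv, add_zero]
    | smul b u _ hu =>
      rw [← op_unop b, op_smul_eq_mul, ← mul_assoc, hu, zero_mul]
    | mem z hz =>
      obtain ⟨a, rfl⟩ := hz
      rw [← mul_assoc, ← hqpow, mul_assoc, eps, Finset.mul_sum]
      rw [Finset.sum_eq_zero, mul_zero]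
      intro γ _
      split_ifs with hγ
      · simp
      · exact hqe γ hγ
  -- Since `x` kills the standard module of `α`, each `e α * (b * x)` lies in the kernel, which `q ^
  -- (m + 1)` annihilates. Another `q ^ m` supplies an element of the ideal of `e α`, whence the
  -- total `2 * m + 1`.
  have hJ : ∀ z ∈ AddSubgroup.closure {z | ∃ a b, z = a * e α * b}, q ^ (m + 1) * (z * x) = 0 := by
    intro z hz
    induction hz using AddSubgroup.closure_induction with
    | zero => simp
    | add u v _ _ hu hv => rw [add_mul, mul_add, hu, hv, add_zero]
    | neg u _ hu => rw [neg_mul, mul_neg, hu, neg_zero]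
    | mem z hz =>
      obtain ⟨a, b, rfl⟩ := hz
      have h1 : e α * (b * x) ∈ kerProjToStd e α := by
        rw [← Std.gen_smul_eq_zero_iff, op_mul, mul_smul, hx]
      have h2 : a * e α * b * x = a * (e α * (b * x)) := by simp only [mul_assoc]
      rw [h2, ← mul_assoc, ← hqpow, mul_assoc, hker _ h1, mul_zero]
  have := hJ _ (pow_mem_span_of_filtration he hF hqz)
  rw [← mul_assoc, ← pow_add] at this
  rwa [show 2 * m + 1 = m + 1 + m by ring]

/-- If the central characters are distinct, the sum of the standard modules is faithful. -/
theorem eq_zero_of_killsStd_of_injective [IsDomain S] [Module.IsTorsionFree S B] {m : ℕ}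
    {F : ℕ → Submodule Bᵐᵒᵖ B} (he : CompleteOrthogonalIdempotents e)
    (hF : IsDeformedStandardFiltration e m F)
    {χ : I → (Subalgebra.center S B →ₐ[S] S)} (hχ : ∀ α, IsCentralCharacter e α (χ α))
    (hinj : Function.Injective χ) {x : B} (hx : KillsStd e x) : x = 0 := by
  classical
  have hsep : ∀ α β, ∃ ζ : Subalgebra.center S B, α ≠ β → χ α ζ ≠ χ β ζ := by
    intro α β
    by_contra! hcon
    exact (hcon 0).1 (hinj (AlgHom.ext fun ζ => (hcon ζ).2))
  choose ζ hζ using hsep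
  -- Lagrange interpolation in the centre: every character but that of `α` vanishes on `p α`.
  let p : I → Subalgebra.center S B := fun α =>
    ∏ β ∈ Finset.univ.erase α, (ζ α β - algebraMap S _ (χ β (ζ α β)))
  have hp : ∀ α γ, γ ≠ α → χ γ (p α) = 0 := by
    intro α γ hγ
    rw [map_prod]
    refine Finset.prod_eq_zero (Finset.mem_erase.2 ⟨hγ, Finset.mem_univ _⟩) ?_
    rw [map_sub, AlgHom.commutes]
    exact sub_self _
  have hp' : ∀ α, χ α (p α) ≠ 0 := by
    intro α
    rw [map_prod, Finset.prod_ne_zero_iff]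
    intro β hβ
    rw [map_sub, AlgHom.commutes]
    exact sub_ne_zero.2 (hζ α β (Finset.mem_erase.1 hβ).1.symm)
  let s : S := ∏ β, χ β (p β)
  have hs : s ≠ 0 := Finset.prod_ne_zero_iff.2 fun β _ => hp' β
  -- Rescaling by the values at the other labels gives all `q α` the same nonzero value `s` under
  -- their own characters.
  let q : I → Subalgebra.center S B := fun α => (∏ β ∈ Finset.univ.erase α, χ β (p β)) • p α
  have hq0 : ∀ α γ, γ ≠ α → χ γ (q α) = 0 := by
    intro α γ hγ
    rw [map_smul, hp α γ hγ, smul_zero]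
  have hqs : ∀ α, χ α (q α) = s := by
    intro α
    rw [map_smul, smul_eq_mul, mul_comm]
    exact Finset.mul_prod_erase _ (fun β => χ β (p β)) (Finset.mem_univ α)
  have hcomm : ∀ α b, b * (q α : B) = q α * b := fun α => Subalgebra.mem_center_iff.1 (q α).2
  let N := 2 * m + 1
  have hqx : ∀ α, (q α : B) ^ N * x = 0 := fun α =>
    pow_mul_eq_zero_of_filtration he hF (hcomm α)
      (fun β hβ v => by rw [hχ β (q α) v, hq0 α β hβ, zero_smul]) (hx α)
  -- All characters vanish on `t`, so `t` is nilpotent; yet it multiplies `x` by `-s ^ N`. As `B` is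
  -- torsion free, `x = 0`.
  let t : Subalgebra.center S B := ∑ α, q α ^ N - algebraMap S _ (s ^ N)
  have ht : KillsStd e (t : B) := by
    intro β v
    rw [hχ β t v, map_sub, map_sum, AlgHom.commutes, Finset.sum_eq_single β, map_pow, hqs,
      Algebra.algebraMap_self, RingHom.id_apply, sub_self, zero_smul]
    · intro α _ hα
      rw [map_pow, hq0 α β hα.symm, zero_pow (by omega)]
    · simp
  have htx : (t : B) * x = (-s ^ N) • x := by
    have h1 : (t : B) = ∑ α, (q α : B) ^ N - algebraMap S B (s ^ N) := by
      simp only [t, AddSubgroupClass.coe_sub, AddSubmonoidClass.coe_finsetSum,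
        SubmonoidClass.coe_pow]
      rfl
    rw [h1, sub_mul, Finset.sum_mul, Finset.sum_eq_zero fun α _ => hqx α, zero_sub, neg_smul,
      Algebra.smul_def]
  have htk : ∀ k, (t : B) ^ k * x = (-s ^ N) ^ k • x := by
    intro k
    induction k with
    | zero => simp
    | succ k ih => rw [pow_succ, mul_assoc, htx, mul_smul_comm, ih, smul_smul, ← pow_succ']
  have h2 := htk m
  rw [hF.pow_eq_zero ht, zero_mul] at h2
  exact (smul_eq_zero_iff_right (pow_ne_zero _ (neg_ne_zero.2 (pow_ne_zero _ hs)))).1 h2.symm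

end Faithful

/-! ### Splitting of filtrations -/

theorem FiltrationSplits.of_complementedLattice {R N : Type*} [Ring R] [AddCommGroup N]
    [Module R N] [ComplementedLattice (Submodule R N)] (m : ℕ) {F : ℕ → Submodule R N}
    (hF : Monotone F) (h0 : F 0 = ⊥) : FiltrationSplits m F := by
  classical
  choose C hC using fun k => exists_isCompl (F k)
  -- By the modular law, a complement of `F j` cut down to `F (j + 1)` is a complement of `F j`
  -- inside `F (j + 1)`.
  let G : Fin m → Submodule R N := fun j => C j ⊓ F (j + 1)
  have hstep : ∀ j : Fin m, F j ⊔ G j = F (j + 1) := by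
    intro j
    change F j ⊔ C j ⊓ F (j + 1) = _
    rw [← sup_inf_assoc_of_le (C j) (hF (Nat.le_succ (j : ℕ))), (hC j).sup_eq_top, top_inf_eq]
  have hdisj : ∀ j : Fin m, ∀ z ∈ F j, z ∈ G j → z = 0 := by
    intro j z hz hz'
    have : z ∈ F j ⊓ C j := ⟨hz, hz'.1⟩
    rwa [(hC j).inf_eq_bot, Submodule.mem_bot] at this
  refine ⟨G, ?_, ?_⟩
  · rw [iSupIndep_iff_finsetSum_eq_zero_imp_eq_zero]
    intro s
    induction s using Finset.induction_on_max with
    | empty => simp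
    | insert a s ha ih =>
      intro v hv hsum
      have hns : a ∉ s := fun h => lt_irrefl _ (ha a h)
      rw [Finset.sum_insert hns] at hsum
      have h1 : ∑ i ∈ s, v i ∈ F a := sum_mem fun i hi =>
        hF (Nat.succ_le_of_lt (ha i hi)) (hv i (Finset.mem_insert_of_mem hi)).2
      have h2 : v a = 0 := by
        refine hdisj a _ ?_ (hv a (Finset.mem_insert_self a s))
        rw [eq_neg_of_add_eq_zero_left hsum]
        exact neg_mem h1
      rw [h2, zero_add] at hsum
      intro i hi
      rcases Finset.mem_insert.1 hi with rfl | hi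
      · exact h2
      · exact ih v (fun i hi => hv i (Finset.mem_insert_of_mem hi)) hsum i hi
  · intro k
    induction k with
    | zero => intro _; simp [h0]
    | succ k ih =>
      intro hk
      have hk' : k < m := hk
      rw [← hstep ⟨k, hk'⟩]
      change F k ⊔ _ = _
      rw [ih hk'.le]
      apply le_antisymm
      · refine sup_le (iSup₂_le fun j hj => ?_) ?_
        · exact le_iSup₂_of_le j (hj.trans (Nat.lt_succ_self k)) le_rfl
        · exact le_iSup₂_of_le ⟨k, hk'⟩ (Nat.lt_succ_self k) le_rfl
      · refine iSup₂_le fun j hj => ?_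
        rcases (Nat.lt_succ_iff.1 hj).lt_or_eq with h | h
        · exact le_sup_of_le_left (le_iSup₂_of_le j h le_rfl)
        · refine le_sup_of_le_right (le_of_eq ?_)
          congr 1
          exact Fin.ext h

/-! ### Passage to the fraction field: the action map and the character map. -/

section BaseChange

variable {S : Type*} [CommRing S] (K : Type*) [Field K] [Algebra S K]

section Localization

variable [IsFractionRing S K] {M : Type*} [AddCommGroup M] [Module S M]

theorem exists_smul_eq_one_tmul [IsDomain S] (z : K ⊗[S] M) :
    ∃ s : S, s ≠ 0 ∧ ∃ m : M, s • z = (1 : K) ⊗ₜ[S] m := by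
  obtain ⟨⟨m, s⟩, h⟩ := IsLocalizedModule.surj (nonZeroDivisors S) (TensorProduct.mk S K M 1) z
  exact ⟨s, nonZeroDivisors.ne_zero s.2, m, h⟩

theorem eq_zero_of_one_tmul_eq_zero [IsDomain S] [Module.IsTorsionFree S M] {m : M}
    (h : (1 : K) ⊗ₜ[S] m = 0) : m = 0 := by
  obtain ⟨s, hs⟩ := (IsLocalizedModule.eq_zero_iff (nonZeroDivisors S)
    (TensorProduct.mk S K M 1)).1 h
  exact (smul_eq_zero_iff_right (nonZeroDivisors.ne_zero s.2)).1 hs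

theorem eq_zero_of_smul_eq_zero {s : S} (hs : s ≠ 0) {V : Type*} [AddCommGroup V]
    [Module K V] [Module S V] [IsScalarTower S K V] {v : V} (h : s • v = 0) : v = 0 := by
  rw [algebra_compatible_smul K s v] at h
  refine (smul_eq_zero_iff_right ?_).1 h
  exact (map_ne_zero_iff _ (IsFractionRing.injective S K)).2 hs

end Localization

theorem end_baseChange_ext {M : Type*} [AddCommGroup M] [Module S M]
    {f g : Module.End K (K ⊗[S] M)} (h : ∀ m, f (1 ⊗ₜ m) = g (1 ⊗ₜ m)) : f = g := by
  refine LinearMap.ext fun u => ?_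
  induction u with
  | zero => rw [map_zero, map_zero]
  | add u v hu hv => rw [map_add, map_add, hu, hv]
  | tmul c m =>
    have : c ⊗ₜ[S] m = c • ((1 : K) ⊗ₜ[S] m) := by rw [smul_tmul', smul_eq_mul, mul_one]
    rw [this, map_smul, map_smul, h]

variable {B : Type*} [Ring B] [Algebra S B]

theorem mem_of_smul_mem [IsFractionRing S K] {P : Submodule (K ⊗[S] B)ᵐᵒᵖ (K ⊗[S] B)} {s : S}
    (hs : s ≠ 0) {z : K ⊗[S] B} (h : s • z ∈ P) : z ∈ P := by
  have h1 := P.smul_mem (op (((algebraMap S K s)⁻¹) ⊗ₜ[S] (1 : B))) h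
  have hs' : algebraMap S K s ≠ 0 := (map_ne_zero_iff _ (IsFractionRing.injective S K)).2 hs
  have h2 : ∀ (c : K) (w : K ⊗[S] B), w * (c ⊗ₜ[S] (1 : B)) = c • w := by
    intro c w
    have := Algebra.commutes c w
    rw [← Algebra.smul_def, Algebra.TensorProduct.algebraMap_apply] at this
    exact this.symm
  rw [op_smul_eq_mul, h2, algebra_compatible_smul K s z, smul_smul, inv_mul_cancel₀ hs',
    one_smul] at h1
  exact h1

theorem exists_smul_eq_of_mem_extendRightIdeal [IsFractionRing S K] [IsDomain S]
    {F : Submodule Bᵐᵒᵖ B} {z : K ⊗[S] B} (hz : z ∈ extendRightIdeal K F) :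
    ∃ s : S, s ≠ 0 ∧ ∃ f ∈ F, s • z = (1 : K) ⊗ₜ[S] f := by
  induction hz using Submodule.span_induction with
  | mem z hz =>
    obtain ⟨f, hf, rfl⟩ := hz
    exact ⟨1, one_ne_zero, f, hf, one_smul _ _⟩
  | zero => exact ⟨1, one_ne_zero, 0, zero_mem _, by simp⟩
  | add u v _ _ hu hv =>
    obtain ⟨s, hs, f, hf, hu⟩ := hu
    obtain ⟨t, ht, g, hg, hv⟩ := hv
    refine ⟨s * t, mul_ne_zero hs ht, t • f + s • g,
      add_mem (Submodule.smul_of_tower_mem F t hf) (Submodule.smul_of_tower_mem F s hg), ?_⟩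
    rw [smul_add, mul_comm, mul_smul, hu, mul_comm, mul_smul, hv, tmul_add, tmul_smul, tmul_smul]
  | smul w u _ hu =>
    obtain ⟨s, hs, f, hf, hu⟩ := hu
    obtain ⟨t, ht, b, hb⟩ := exists_smul_eq_one_tmul K (unop w)
    refine ⟨s * t, mul_ne_zero hs ht, f * b, F.smul_mem (op b) hf, ?_⟩
    rw [← op_unop w, op_smul_eq_mul, mul_smul, ← mul_smul_comm, ← smul_mul_assoc, hu, hb,
      Algebra.TensorProduct.tmul_mul_tmul, one_mul]

theorem extendRightIdeal_mono {F F' : Submodule Bᵐᵒᵖ B} (h : F ≤ F') :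
    extendRightIdeal (S := S) K F ≤ extendRightIdeal K F' :=
  Submodule.span_mono (Set.image_mono h)

theorem extendRightIdeal_bot :
    extendRightIdeal (S := S) K (⊥ : Submodule Bᵐᵒᵖ B) = ⊥ := by
  rw [extendRightIdeal, Submodule.span_eq_bot]
  rintro _ ⟨f, hf, rfl⟩
  rw [(Submodule.mem_bot _).1 hf]
  exact tmul_zero _ _

theorem extendRightIdeal_top :
    extendRightIdeal (S := S) K (⊤ : Submodule Bᵐᵒᵖ B) = ⊤ := by
  rw [Submodule.eq_top_iff']
  intro z
  have h1 : (1 : K ⊗[S] B) ∈ extendRightIdeal (S := S) K (⊤ : Submodule Bᵐᵒᵖ B) :=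
    Submodule.subset_span ⟨1, trivial, rfl⟩
  have := Submodule.smul_mem _ (op z) h1
  rwa [op_smul_eq_mul, one_mul] at this

variable {I : Type*} [Fintype I] [PartialOrder I] {e : I → B}

theorem actionMap_tmul (c : K) (b : B) (α : I) :
    actionMap K e (c ⊗ₜ[S] b) α = c • (rightAction e α b : Module.End S _).baseChange K := by
  rw [actionMap, LinearMap.pi_apply, LinearMap.liftBaseChange_tmul]
  rfl

theorem actionMap_tmul_tmul (c d : K) (b : B) (α : I) (v : Std e α) :
    actionMap K e (c ⊗ₜ[S] b) α (d ⊗ₜ[S] v) = (c * d) ⊗ₜ[S] (op b • v) := by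
  rw [actionMap_tmul, LinearMap.smul_apply, LinearMap.baseChange_tmul, smul_tmul', smul_eq_mul]
  rfl

/-- Right multiplication reverses products, hence the opposite ring in
`filtrationSplits_of_bijective`. -/
theorem actionMap_mul (z w : K ⊗[S] B) (α : I) :
    actionMap K e (z * w) α = actionMap K e w α * actionMap K e z α := by
  induction z with
  | zero => simp
  | add z z' hz hz' => rw [add_mul, map_add, Pi.add_apply, hz, hz', map_add, Pi.add_apply, mul_add]
  | tmul c b =>
    induction w with
    | zero => simp
    | add w w' hw hw' =>
      rw [mul_add, map_add, Pi.add_apply, hw, hw', map_add, Pi.add_apply, add_mul]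
    | tmul d b' =>
      rw [Algebra.TensorProduct.tmul_mul_tmul]
      refine end_baseChange_ext K fun v => ?_
      rw [Module.End.mul_apply, actionMap_tmul_tmul, actionMap_tmul_tmul, actionMap_tmul_tmul,
        op_mul, mul_smul, mul_one, mul_one, mul_comm c d]

theorem actionMap_one : actionMap K e (1 : K ⊗[S] B) = 1 := by
  funext α
  rw [Algebra.TensorProduct.one_def]
  refine end_baseChange_ext K fun v => ?_
  rw [actionMap_tmul_tmul, Pi.one_apply, Module.End.one_apply, op_one, one_smul, one_mul]

theorem KillsStd.actionMap_eq_zero {b : B} (hb : KillsStd e b) :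
    actionMap K e ((1 : K) ⊗ₜ[S] b) = 0 := by
  funext α
  refine end_baseChange_ext K fun v => ?_
  rw [actionMap_tmul_tmul, hb α v, tmul_zero]
  rfl

variable [IsFractionRing S K] [IsDomain S]

theorem killsStd_of_actionMap_eq_zero [∀ α, Module.IsTorsionFree S (Std e α)] {b : B}
    (hb : actionMap K e ((1 : K) ⊗ₜ[S] b) = 0) : KillsStd e b := by
  intro α v
  have h1 := LinearMap.congr_fun (congrFun hb α) (1 ⊗ₜ v)
  rw [actionMap_tmul_tmul, one_mul] at h1
  exact eq_zero_of_one_tmul_eq_zero K h1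

theorem actionMap_injective_of_faithful [∀ α, Module.IsTorsionFree S (Std e α)]
    (h : ∀ b, KillsStd e b → b = 0) : Function.Injective (actionMap (S := S) K e) := by
  rw [injective_iff_map_eq_zero]
  intro z hz
  obtain ⟨s, hs, b, hb⟩ := exists_smul_eq_one_tmul K z
  have h1 : b = 0 := by
    refine h b (killsStd_of_actionMap_eq_zero (S := S) K ?_)
    rw [← hb, algebra_compatible_smul K s z, map_smul, hz, smul_zero]
  rw [h1, tmul_zero] at hb
  exact eq_zero_of_smul_eq_zero K hs hb

theorem faithful_of_actionMap_injective [Module.IsTorsionFree S B]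
    (h : Function.Injective (actionMap (S := S) K e)) (b : B) (hb : KillsStd e b) : b = 0 :=
  eq_zero_of_one_tmul_eq_zero K (h ((hb.actionMap_eq_zero K).trans (map_zero _).symm))

/-- If the induced filtration splits, the sum of the standard modules is faithful. -/
theorem faithful_of_filtrationSplits [Module.IsTorsionFree S B] {m : ℕ}
    {F : ℕ → Submodule Bᵐᵒᵖ B} (hF : IsDeformedStandardFiltration e m F)
    (hsplit : FiltrationSplits m (fun k => extendRightIdeal (S := S) K (F k)))
    (b : B) (hb : KillsStd e b) : b = 0 := by
  obtain ⟨G, hG, hFG⟩ := hsplit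
  have h1 : ∀ j : Fin m, ∀ g ∈ G j, g * ((1 : K) ⊗ₜ[S] b) = 0 := by
    intro j g hg
    have h2 : g ∈ extendRightIdeal (S := S) K (F (j + 1)) := by
      have := hFG (j + 1) j.2
      dsimp only at this
      rw [this]
      exact Submodule.mem_iSup_of_mem j (Submodule.mem_iSup_of_mem (Nat.lt_succ_self _) hg)
    obtain ⟨s, hs, f, hf, hsf⟩ := exists_smul_eq_of_mem_extendRightIdeal K h2
    -- After clearing denominators, multiplication by `b` sends `g` one step down the filtration. It
    -- also preserves the right ideal `G j`, which meets `F j` trivially, so the product is zero.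
    have h3 : g * ((1 : K) ⊗ₜ[S] b) ∈ extendRightIdeal (S := S) K (F j) := by
      refine mem_of_smul_mem K hs ?_
      rw [← smul_mul_assoc, hsf, Algebra.TensorProduct.tmul_mul_tmul, one_mul]
      exact Submodule.subset_span ⟨_, hF.mul_mem hb j.2 hf, rfl⟩
    have h4 : g * ((1 : K) ⊗ₜ[S] b) ∈ G j := (G j).smul_mem (op _) hg
    have h5 := hFG j j.2.le
    dsimp only at h5
    rw [h5] at h3
    have h6 : (⨆ i : Fin m, ⨆ _ : (i : ℕ) < j, G i) ≤ ⨆ i, ⨆ _ : i ≠ j, G i :=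
      iSup₂_le fun i hi => le_iSup₂_of_le i (fun h => lt_irrefl _ (h ▸ hi)) le_rfl
    exact Submodule.disjoint_def.1 (hG j) _ h4 (h6 h3)
  have htop : (1 : K ⊗[S] B) ∈ ⨆ j, G j := by
    have h2 := hFG m le_rfl
    dsimp only at h2
    rw [hF.2.2.1, extendRightIdeal_top] at h2
    have h3 : (⨆ j : Fin m, ⨆ _ : (j : ℕ) < m, G j) ≤ ⨆ j, G j :=
      iSup₂_le fun j _ => le_iSup G j
    exact h3 (h2 ▸ Submodule.mem_top)
  have h2 : ∀ z ∈ ⨆ j, G j, z * ((1 : K) ⊗ₜ[S] b) = 0 := by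
    intro z hz
    exact Submodule.iSup_induction G (motive := fun z => z * ((1 : K) ⊗ₜ[S] b) = 0) hz h1
      (zero_mul _) fun u v hu hv => by rw [add_mul, hu, hv, add_zero]
  have h3 := h2 1 htop
  rw [one_mul] at h3
  exact eq_zero_of_one_tmul_eq_zero K h3

/-- If the action map is bijective, the base change of the algebra is semisimple. -/
theorem filtrationSplits_of_bijective [∀ α, Module.Finite S (Std e α)] {m : ℕ}
    {F : ℕ → Submodule Bᵐᵒᵖ B} (hF : IsDeformedStandardFiltration e m F)
    (h : Function.Bijective (actionMap (S := S) K e)) :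
    FiltrationSplits m (fun k => extendRightIdeal (S := S) K (F k)) := by
  let φ : (K ⊗[S] B)ᵐᵒᵖ →+* (∀ α : I, Module.End K (K ⊗[S] Std e α)) :=
    { toFun := fun z => actionMap K e (unop z)
      map_one' := actionMap_one K
      map_mul' := fun z w => funext fun α => actionMap_mul K (unop w) (unop z) α
      map_zero' := map_zero _
      map_add' := fun z w => map_add (actionMap K e) (unop z) (unop w) }
  have hss : ∀ α, IsSemisimpleRing (Module.End K (K ⊗[S] Std e α)) := fun α =>
    IsSemisimpleRing.moduleEnd K _
  have : IsSemisimpleRing (K ⊗[S] B)ᵐᵒᵖ :=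
    RingEquiv.isSemisimpleRing (R := ∀ α : I, Module.End K (K ⊗[S] Std e α))
      (RingEquiv.ofBijective φ (h.comp unop_bijective)).symm
  have h1 : IsSemisimpleModule (K ⊗[S] B)ᵐᵒᵖ (K ⊗[S] B) := inferInstance
  have h2 : ComplementedLattice (Submodule (K ⊗[S] B)ᵐᵒᵖ (K ⊗[S] B)) := h1.toComplementedLattice
  refine FiltrationSplits.of_complementedLattice m
    (fun k l hkl => extendRightIdeal_mono K (hF.1 hkl)) ?_
  rw [hF.2.1, extendRightIdeal_bot]

theorem charMap_tmul (χ : I → (Subalgebra.center S B →ₐ[S] S)) (c : K)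
    (ζ : Subalgebra.center S B) (α : I) :
    charMap K χ (c ⊗ₜ[S] ζ) α = c * algebraMap S K (χ α ζ) := by
  rw [charMap, LinearMap.pi_apply, LinearMap.liftBaseChange_tmul, smul_eq_mul]
  rfl

theorem injective_of_charMap_surjective {χ : I → (Subalgebra.center S B →ₐ[S] S)}
    (h : Function.Surjective (charMap K χ)) : Function.Injective χ := by
  classical
  intro α β hαβ
  by_contra hne
  have h1 : ∀ z, charMap K χ z α = charMap K χ z β := by
    intro z
    induction z with
    | zero => rw [map_zero, Pi.zero_apply, Pi.zero_apply]
    | add z w hz hw => rw [map_add, Pi.add_apply, Pi.add_apply, hz, hw]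
    | tmul c ζ => rw [charMap_tmul, charMap_tmul, hαβ]
  obtain ⟨z, hz⟩ := h (Pi.single α 1)
  have h1 := h1 z
  rw [hz, Pi.single_eq_same, Pi.single_eq_of_ne (Ne.symm hne)] at h1
  exact one_ne_zero h1

theorem charMap_injective {χ : I → (Subalgebra.center S B →ₐ[S] S)}
    (hχ : ∀ α, IsCentralCharacter e α (χ α)) (h : ∀ b, KillsStd e b → b = 0) :
    Function.Injective (charMap K χ) := by
  rw [injective_iff_map_eq_zero]
  intro z hz
  obtain ⟨s, hs, ζ, hζ⟩ := exists_smul_eq_one_tmul K z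
  have h1 : (ζ : B) = 0 := by
    refine h ζ fun α v => ?_
    have h2 : charMap K χ (s • z) α = 0 := by
      rw [algebra_compatible_smul K s z, map_smul, hz, smul_zero, Pi.zero_apply]
    rw [hζ, charMap_tmul, one_mul] at h2
    rw [hχ α ζ v, (map_eq_zero_iff _ (IsFractionRing.injective S K)).1 h2, zero_smul]
  have h2 : ζ = 0 := Subtype.ext h1
  rw [h2, tmul_zero] at hζ
  exact eq_zero_of_smul_eq_zero K hs hζ

/-- The preimage of the identity of one block, with denominators cleared, is an element `b` of the
algebra acting by scalars on each standard module. Injectivity of the action map makes `b` central,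
and its characters are read off on the generators. -/
theorem charMap_surjective [∀ α, Module.IsTorsionFree S (Std e α)] [Module.IsTorsionFree S B]
    (hgen : ∀ α, Std.gen e α ≠ 0) {χ : I → (Subalgebra.center S B →ₐ[S] S)}
    (hχ : ∀ α, IsCentralCharacter e α (χ α))
    (h : Function.Bijective (actionMap (S := S) K e)) : Function.Surjective (charMap K χ) := by
  classical
  have hsingle : ∀ α, ∃ z, charMap K χ z = Pi.single α 1 := by
    intro α
    obtain ⟨z, hz⟩ := h.2 (Pi.single α 1)
    obtain ⟨s, hs, b, hb⟩ := exists_smul_eq_one_tmul K z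
    have hab : actionMap K e ((1 : K) ⊗ₜ[S] b) = Pi.single α (algebraMap S K s • 1) := by
      rw [← hb, algebra_compatible_smul K s z, map_smul, hz]
      ext1 β
      by_cases hβ : β = α
      · subst hβ; simp
      · simp [hβ]
    have hcenter : b ∈ Subalgebra.center S B := by
      rw [Subalgebra.mem_center_iff]
      intro c
      rw [← sub_eq_zero]
      apply eq_zero_of_one_tmul_eq_zero (S := S) K
      rw [tmul_sub, sub_eq_zero]
      apply h.1
      have h1 : ∀ b c : B, (1 : K) ⊗ₜ[S] (b * c) = ((1 : K) ⊗ₜ[S] b) * ((1 : K) ⊗ₜ[S] c) :=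
        fun b c => by rw [Algebra.TensorProduct.tmul_mul_tmul, one_mul]
      funext β
      rw [h1, h1, actionMap_mul, actionMap_mul, hab]
      by_cases hβ : β = α
      · subst hβ; simp
      · simp [hβ]
    have hval : ∀ β, χ β ⟨b, hcenter⟩ = (Pi.single α s : I → S) β := by
      intro β
      have h1 := LinearMap.congr_fun (congrFun hab β) (1 ⊗ₜ Std.gen e β)
      rw [actionMap_tmul_tmul, one_mul, hχ β ⟨b, hcenter⟩] at h1
      have h2 : (1 : K) ⊗ₜ[S] ((χ β ⟨b, hcenter⟩ - (Pi.single α s : I → S) β) • Std.gen e β)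
          = 0 := by
        rw [sub_smul, tmul_sub, h1, sub_eq_zero]
        by_cases hβ : β = α
        · subst hβ
          rw [Pi.single_eq_same, Pi.single_eq_same, LinearMap.smul_apply, Module.End.one_apply,
            tmul_smul, algebra_compatible_smul K s]
        · simp [hβ]
      have h3 := eq_zero_of_one_tmul_eq_zero K h2
      exact sub_eq_zero.1 ((smul_eq_zero_iff_left (hgen β)).1 h3)
    have hs' : algebraMap S K s ≠ 0 := (map_ne_zero_iff _ (IsFractionRing.injective S K)).2 hs
    refine ⟨(algebraMap S K s)⁻¹ ⊗ₜ ⟨b, hcenter⟩, ?_⟩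
    funext β
    rw [charMap_tmul, hval]
    by_cases hβ : β = α
    · subst hβ; simp [hs']
    · simp [hβ]
  choose z hz using hsingle
  intro v
  refine ⟨∑ α, v α • z α, ?_⟩
  rw [map_sum]
  funext β
  simp [hz, Pi.single_apply]

end BaseChange

theorem surjective_of_injective_of_finrank_eq {K V W : Type*} [Field K] [AddCommMonoid V]
    [AddCommMonoid W] [Module K V] [Module K W] [Module.Finite K V] [Module.Finite K W]
    (h : Module.finrank K V = Module.finrank K W) {f : V →ₗ[K] W} (hf : Function.Injective f) :
    Function.Surjective f := by
  let _ : AddCommGroup V := Module.addCommMonoidToAddCommGroup K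
  let _ : AddCommGroup W := Module.addCommMonoidToAddCommGroup K
  exact (LinearMap.injective_iff_surjective_of_finrank_eq_finrank h).1 hf

/-! ### Rank count and the final equivalences. -/

section CellularBaseChange

variable {S : Type*} [CommRing S] [IsDomain S] (K : Type*) [Field K] [Algebra S K]
  [IsFractionRing S K] {B : Type*} [Ring B] [Algebra S B] {I : Type*} [Fintype I] [PartialOrder I]
  {e : I → B} {n : I → ℕ} {x y : ∀ α, Fin (n α) → B}

/-- Both sides of the action map have dimension `∑ n_α²` over `K`, so injectivity is enough; it
amounts to faithfulness after clearing denominators. -/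
theorem IsCellularBasis.actionMap_bijective_iff (h : IsCellularBasis S e n x y) :
    Function.Bijective (actionMap (S := S) K e) ↔ ∀ b, KillsStd e b → b = 0 := by
  have hB : Module.Free S B := Module.Free.of_basis h.basis
  have hBf : Module.Finite S B := Module.Finite.of_basis h.basis
  have hV : ∀ α, Module.Free S (Std e α) := fun α => Module.Free.of_basis (h.stdBasis α)
  have hVf : ∀ α, Module.Finite S (Std e α) := fun α => Module.Finite.of_basis (h.stdBasis α)
  refine ⟨fun hbij => faithful_of_actionMap_injective K hbij.1, fun hf => ?_⟩
  have hinj := actionMap_injective_of_faithful (S := S) K hf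
  have hdim : Module.finrank K (K ⊗[S] B) =
      Module.finrank K (∀ α : I, Module.End K (K ⊗[S] Std e α)) := by
    rw [Module.finrank_baseChange, Module.finrank_eq_card_basis h.basis, Module.finrank_pi_fintype]
    simp only [Module.finrank_linearMap, Module.finrank_baseChange,
      Module.finrank_eq_card_basis (h.stdBasis _)]
    simp
  exact ⟨hinj, surjective_of_injective_of_finrank_eq hdim hinj⟩

/-- The equivalences between splitting, semisimplicity and distinctness of central characters. -/
theorem IsCellularBasis.tfae (h : IsCellularBasis S e n x y)
    {χ : I → (Subalgebra.center S B →ₐ[S] S)} (hχ : ∀ α, IsCentralCharacter e α (χ α))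
    {m : ℕ} {F : ℕ → Submodule Bᵐᵒᵖ B} (hF : IsDeformedStandardFiltration e m F) :
    List.TFAE [
      FiltrationSplits m (fun k => extendRightIdeal (S := S) K (F k)),
      Function.Bijective (actionMap (S := S) K e),
      Function.Bijective (charMap K χ),
      Function.Injective χ] := by
  have hB : Module.Free S B := Module.Free.of_basis h.basis
  have hV : ∀ α, Module.Free S (Std e α) := fun α => Module.Free.of_basis (h.stdBasis α)
  have hVf : ∀ α, Module.Finite S (Std e α) := fun α => Module.Finite.of_basis (h.stdBasis α)
  tfae_have 1 → 2 := fun hs =>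
    (h.actionMap_bijective_iff K).2 (faithful_of_filtrationSplits K hF hs)
  tfae_have 2 → 1 := filtrationSplits_of_bijective K hF
  tfae_have 2 → 3 := fun hb =>
    ⟨charMap_injective K hχ ((h.actionMap_bijective_iff K).1 hb),
      charMap_surjective K h.gen_ne_zero hχ hb⟩
  tfae_have 3 → 4 := fun hb => injective_of_charMap_surjective K hb.2
  tfae_have 4 → 2 := fun hi => (h.actionMap_bijective_iff K).2 fun _ hb =>
    eq_zero_of_killsStd_of_injective h.idempotents hF hχ hi hb
  tfae_finish

end CellularBaseChange

end StdKoszul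

end

theorem mainTheorem9 {I : Type*} [Fintype I] [PartialOrder I]
    {A : Type u} [Ring A] [Algebra ℂ A] (𝒜 : ℕ → Submodule ℂ A) [GradedAlgebra 𝒜] (e : I → A)
    (hquad : StdKoszul.IsQuadratic 𝒜 e) (hstd : StdKoszul.IsStandardKoszul 𝒜 e)
    (hop : ∃ σ : A ≃ₐ[ℂ] Aᵐᵒᵖ, ∀ α, σ (e α) = MulOpposite.op (e α))
    (U : Type*) [AddCommGroup U] [Module ℂ U] [FiniteDimensional ℂ U]
    {At : Type*} [Ring At] [Algebra ℂ At] [Algebra (SymmetricAlgebra ℂ U) At]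
    [IsScalarTower ℂ (SymmetricAlgebra ℂ U) At]
    (ℬ : ℕ → Submodule ℂ At) [GradedAlgebra ℬ] (et : I → At) (π : At →ₐ[ℂ] A)
    (hdef : StdKoszul.IsFlatGradedDeformation 𝒜 e U ℬ et π)
    (K : Type*) [Field K] [Algebra (SymmetricAlgebra ℂ U) K]
    [IsFractionRing (SymmetricAlgebra ℂ U) K] :
    (∃! h : I → (Subalgebra.center (SymmetricAlgebra ℂ U) At →ₐ[SymmetricAlgebra ℂ U]
        SymmetricAlgebra ℂ U), ∀ α, StdKoszul.IsCentralCharacter et α (h α)) ∧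
    (∃ m F, StdKoszul.IsDeformedStandardFiltration et m F) ∧
    ∀ h : I → (Subalgebra.center (SymmetricAlgebra ℂ U) At →ₐ[SymmetricAlgebra ℂ U]
        SymmetricAlgebra ℂ U), (∀ α, StdKoszul.IsCentralCharacter et α (h α)) →
    ∀ (m : ℕ) (F : ℕ → Submodule Atᵐᵒᵖ At), StdKoszul.IsDeformedStandardFiltration et m F →
      List.TFAE [
        StdKoszul.FiltrationSplits m
          (fun k => StdKoszul.extendRightIdeal (S := SymmetricAlgebra ℂ U) K (F k)),
        Function.Bijective (StdKoszul.actionMap (S := SymmetricAlgebra ℂ U) K et),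
        Function.Bijective (StdKoszul.charMap K h),
        Function.Injective h] := by
  -- The symmetric algebra is a domain because it embeds in the field `K`.
  have hinj := IsFractionRing.injective (SymmetricAlgebra ℂ U) K
  have hdom : IsDomain (SymmetricAlgebra ℂ U) := hinj.isDomain (algebraMap _ K)
  have hfin := hstd.finite
  obtain ⟨σ, hσ⟩ := hop
  obtain ⟨n, x, y, hxy⟩ := StdKoszul.exists_isCellularFamily 𝒜 hquad.idempotents
    hquad.linearIndependent hquad.span_eq hstd.quasiHereditary σ hσ
  obtain ⟨X, Y, hXY⟩ := hdef.exists_isCellularBasis hxy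
  exact ⟨hXY.existsUnique_character, hXY.exists_filtration,
    fun h hh m F hF => hXY.tfae K hh hF⟩
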